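/- Let $(N_1,g_1)$, $(N_2,g_2)$ and $(\tilde M,\tilde g)$ be smooth finite-dimensional Riemannian manifolds without boundary, let $n_2=\dim N_2$, let $f:N_1\to(0,\infty)$ be a smooth function, and let $M=N_1\times_f N_2$ be the warped product, that is, $N_1\times N_2$ with the metric $g_1+f^2g_2$. Denote by $\mathfrak D_1,\mathfrak D_2\subset TM$ the distributions tangent to the leaves $N_1\times\{y\}$ and to the fibers $\{y\}\times N_2$. Let $\varphi:M\to\tilde M$ be a smooth isometric immersion with second fundamental form $h(X,Y)=(\tilde\nabla_XY)^\perp$. Assume that $\varphi$ is $\mathfrak D$-minimal, i.e. that for $i=1$ or for $i=2$ the partial mean curvature vector $\frac1{\dim N_i}\sum_a h(e_a,e_a)$ ($(e_a)$ an orthonormal basis of $\mathfrak D_i$ at the point considered; the vector is $0$ by convention if $\dim N_i=0$) vanishes at every point of $M$. Then at every point $x=(x_1,x_2)$ of $M$ $$\|h(\mathfrak D_1,\mathfrak D_2)\|^2=\tilde\tau(T_xM)-\tilde\tau(T_xN_1)-\tilde\tau(T_xN_2)-\frac{n_2\,(\Delta f)(x_1)}{f(x_1)}.$$ Here $\|h(\mathfrak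 D_1,\mathfrak D_2)\|^2=\sum_a\sum_A\tilde g(h(e_a,e_A),h(e_a,e_A))$ for orthonormal bases $(e_a)$ of $\mathfrak D_1$ and $(e_A)$ of $\mathfrak D_2$ at $x$. The spaces $T_xM$, $T_xN_1$, $T_xN_2$ are regarded as the subspaces $d\varphi_x(T_xM)$, $d\varphi_x(\mathfrak D_1)$, $d\varphi_x(\mathfrak D_2)$ of $T_{\varphi(x)}\tilde M$. For a subspace $L$ of $T_{\varphi(x)}\tilde M$ with orthonormal basis $(e_i)$, $\tilde\tau(L)=\sum_{i<j}\tilde K(e_i\wedge e_j)$, where $\tilde K(X\wedge Y)=\tilde g(\tilde R(X,Y)Y,X)/\bigl(\tilde g(X,X)\tilde g(Y,Y)-\tilde g(X,Y)^2\bigr)$ is the sectional curvature of $\tilde M$. Finally, $\Delta f=\sum_i\bigl((\nabla_{e_i}e_i)f-e_ie_if\bigr)$, for a local orthonormal frame $(e_i)$ of $N_1$ and its Levi-Civita connection $\nabla$, is the Laplacian of $(N_1,g_1)$ with this sign. -/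

import Mathlib

open Bundle
open scoped Manifold ContDiff

noncomputable section

namespace WarpedChen

section LinearAlgebra

variable {V : Type*} [AddCommGroup V] [Module ℝ V]

/-- `e` is an orthonormal basis of the subspace `L` for the symmetric bilinear form `B`. -/
def IsOrthonormalFrame (B : V → V → ℝ) (L : Submodule ℝ V) {ι : Type*} [DecidableEq ι]
    (e : ι → V) : Prop :=
  (∀ i j, B (e i) (e j) = if i = j then 1 else 0) ∧ Submodule.span ℝ (Set.range e) = L

/-- Every finite-dimensional subspace has an orthonormal basis for an inner product. -/
theorem exists_isOrthonormalFrame (B : V →ₗ[ℝ] V →ₗ[ℝ] ℝ) (hs : ∀ u v, B u v = B v u)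
    (hp : ∀ v, v ≠ 0 → 0 < B v v) (L : Submodule ℝ V) [FiniteDimensional ℝ L] :
    ∃ e : Fin (Module.finrank ℝ L) → V, IsOrthonormalFrame (fun u v => B u v) L e := by
  let c : InnerProductSpace.Core ℝ L :=
    { inner := fun u v => B u v
      conj_inner_symm := fun u v => by simpa using hs v u
      re_inner_nonneg := fun u => by
        by_cases h : (u : V) = 0
        · simp [h]
        · simpa using (hp u h).le
      add_left := fun u v w => by simp
      smul_left := fun u v r => by simp
      definite := fun u h => by
        by_contra hu
        exact (hp u (fun h0 => hu (Subtype.ext h0))).ne' h }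
  let _ : NormedAddCommGroup L := c.toNormedAddCommGroup
  let _ : InnerProductSpace ℝ L := InnerProductSpace.ofCore c.toCore
  let b := stdOrthonormalBasis ℝ L
  refine ⟨fun i => (b i : V), fun i j => ?_, ?_⟩
  · exact orthonormal_iff_ite.mp b.orthonormal i j
  · have h := b.toBasis.span_eq
    have h2 : (fun i => (b i : V)) = L.subtype ∘ b := rfl
    rw [h2, Set.range_comp, Submodule.span_image]
    rw [OrthonormalBasis.coe_toBasis] at h
    rw [h]
    simp

open Classical in
/-- An orthonormal basis of the subspace `L` (the quantities below do not depend on its choice). -/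
def orthonormalFrame (B : V → V → ℝ) (L : Submodule ℝ V) : Fin (Module.finrank ℝ L) → V :=
  if h : ∃ e : Fin (Module.finrank ℝ L) → V, IsOrthonormalFrame B L e then h.choose else 0

/-- The chosen frame is orthonormal as soon as `B` is an inner product. -/
theorem isOrthonormalFrame_orthonormalFrame (B : V →ₗ[ℝ] V →ₗ[ℝ] ℝ)
    (hs : ∀ u v, B u v = B v u) (hp : ∀ v, v ≠ 0 → 0 < B v v) (L : Submodule ℝ V)
    [FiniteDimensional ℝ L] :
    IsOrthonormalFrame (fun u v => B u v) L (orthonormalFrame (fun u v => B u v) L) := by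
  have h := exists_isOrthonormalFrame B hs hp L
  rw [orthonormalFrame, dif_pos h]
  exact h.choose_spec

/-- The component of `w` orthogonal to the subspace `L`. -/
def normalPart (B : V → V → ℝ) (L : Submodule ℝ V) (w : V) : V :=
  w - ∑ i, B w (orthonormalFrame B L i) • orthonormalFrame B L i

end LinearAlgebra

section Local

variable {E : Type*} [NormedAddCommGroup E] [NormedSpace ℝ E]

/-- The Christoffel symbols of a metric `G` on (an open subset of) a vector space:
`christoffel G z u v` is the vector `Γ_z(u, v)` such that, for all `w`,
`2 G_z(Γ_z(u, v), w) = (∂_u G)_z(v, w) + (∂_v G)_z(u, w) - (∂_w G)_z(u, v)`.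
It is the value at `z` of the Levi-Civita derivative `∇_u v` of the constant field `v`. -/
def christoffel (G : E → E →L[ℝ] E →L[ℝ] ℝ) (z u v : E) : E :=
  (G z).inverse ((1 / 2 : ℝ) •
    (fderiv ℝ G z u v + fderiv ℝ G z v u - ((fderiv ℝ G z).flip u).flip v))

/-- The curvature tensor `R(u, v) w = ∇_u ∇_v w - ∇_v ∇_u w` (constant fields `u`, `v`, `w`)
of a metric `G` on an open subset of a vector space. -/
def localCurvature (G : E → E →L[ℝ] E →L[ℝ] ℝ) (z u v w : E) : E :=
  fderiv ℝ (fun y => christoffel G y v w) z u - fderiv ℝ (fun y => christoffel G y u w) z v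
    + christoffel G z u (christoffel G z v w) - christoffel G z v (christoffel G z u w)

end Local

section Manifold

variable {E : Type*} [NormedAddCommGroup E] [NormedSpace ℝ E]
  {N : Type*} [TopologicalSpace N] [ChartedSpace E N] [IsManifold 𝓘(ℝ, E) ∞ N]

variable (E N) in
/-- Smooth Riemannian metrics on the manifold `N` (without boundary) modelled on `E`. -/
abbrev Metric : Type _ :=
  ContMDiffRiemannianMetric 𝓘(ℝ, E) ∞ E (fun x : N => TangentSpace 𝓘(ℝ, E) x)

/-- The metric `g` in the preferred chart `ψ` at `p`: the pull-back of `g` by `ψ⁻¹`. The tangent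
space at `p` is identified with `E`, by definition, through the derivative of `ψ` at `p`, so that
tensors at `p` can be computed at the point `ψ p` of this chart. -/
def chartMetric (g : Metric E N) (p : N) (z : E) : E →L[ℝ] E →L[ℝ] ℝ :=
  let A : E →L[ℝ] E := mfderiv 𝓘(ℝ, E) 𝓘(ℝ, E) (extChartAt 𝓘(ℝ, E) p).symm z
  let B : E →L[ℝ] E →L[ℝ] ℝ := g.inner ((extChartAt 𝓘(ℝ, E) p).symm z)
  B.bilinearComp A A

/-- The Riemannian curvature tensor `R(u, v) w` of `g` at `p`. -/
def riemannCurvature (g : Metric E N) (p : N) (u v w : TangentSpace 𝓘(ℝ, E) p) :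
    TangentSpace 𝓘(ℝ, E) p :=
  localCurvature (E := E) (chartMetric g p) (extChartAt 𝓘(ℝ, E) p p) u v w

/-- The sectional curvature `K(u ∧ v)` of the plane spanned by `u` and `v`. -/
def sectionalCurvature (g : Metric E N) (p : N) (u v : TangentSpace 𝓘(ℝ, E) p) : ℝ :=
  g.inner p (riemannCurvature g p u v v) u /
    (g.inner p u u * g.inner p v v - g.inner p u v ^ 2)

/-- The scalar curvature `τ(L) = ∑_{i < j} K(e_i ∧ e_j)` of a subspace `L` of the tangent space
of `N` at `p`, where `e` is an orthonormal basis of `L`. -/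
def scalarCurvature (g : Metric E N) (p : N) (L : Submodule ℝ (TangentSpace 𝓘(ℝ, E) p)) : ℝ :=
  ∑ i, ∑ j ∈ Finset.Ioi i,
    sectionalCurvature g p (orthonormalFrame (fun u v => g.inner p u v) L i)
      (orthonormalFrame (fun u v => g.inner p u v) L j)

/-- The Laplacian `Δ ψ = ∑ i, ((∇_{e_i} e_i) ψ - e_i (e_i ψ))` of a function `ψ` at `p`, where `e`
is an orthonormal basis of the tangent space at `p`, extended by constant fields in the chart
(the summands are tensorial: they are minus the Hessian of `ψ` on `(e_i, e_i)`). -/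
def laplacian (g : Metric E N) (ψ : N → ℝ) (p : N) : ℝ :=
  let z : E := extChartAt 𝓘(ℝ, E) p p
  let ψ' : E → ℝ := fun y => ψ ((extChartAt 𝓘(ℝ, E) p).symm y)
  let e : Fin (Module.finrank ℝ (⊤ : Submodule ℝ (TangentSpace 𝓘(ℝ, E) p))) → E :=
    orthonormalFrame (fun u v => g.inner p u v) ⊤
  ∑ i, (fderiv ℝ ψ' z (christoffel (chartMetric g p) z (e i) (e i))
    - fderiv ℝ (fderiv ℝ ψ') z (e i) (e i))

end Manifold

section Submanifold

variable {E H : Type*} [NormedAddCommGroup E] [NormedSpace ℝ E] [TopologicalSpace H]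
  {I : ModelWithCorners ℝ E H} {M : Type*} [TopologicalSpace M] [ChartedSpace H M]
  {F : Type*} [NormedAddCommGroup F] [NormedSpace ℝ F]
  {P : Type*} [TopologicalSpace P] [ChartedSpace F P] [IsManifold 𝓘(ℝ, F) ∞ P]

variable (I) in
/-- The image of the tangent space of `M` at `x` in the tangent space of `P` at `φ x`. -/
def tangentImage (φ : M → P) (x : M) (D : Submodule ℝ (TangentSpace I x)) :
    Submodule ℝ (TangentSpace 𝓘(ℝ, F) (φ x)) :=
  D.map (mfderiv I 𝓘(ℝ, F) φ x).toLinearMap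

variable (I) in
/-- The ambient derivative `∇̃_u (dφ V)` at `x`, along `φ : M → P`, where `V` is the field on `M`
that extends `v` and is constant in the chart at `x`. In the charts at `x` and `φ x`, where `φ`
reads `Φ`, this is `Φ''(u, v) + Γ̃(Φ' u, Φ' v)`. (`M` has no boundary.) -/
def ambientDerivative (g : Metric F P) (φ : M → P) (x : M) (u v : TangentSpace I x) :
    TangentSpace 𝓘(ℝ, F) (φ x) :=
  let Φ : E → F := writtenInExtChartAt I 𝓘(ℝ, F) x φ
  let z : E := extChartAt I x x
  (fderiv ℝ (fderiv ℝ Φ) z u v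
    + christoffel (chartMetric g (φ x)) (extChartAt 𝓘(ℝ, F) (φ x) (φ x))
        (fderiv ℝ Φ z u) (fderiv ℝ Φ z v) : F)

variable (I) in
/-- The second fundamental form `h(u, v)`: the component of `∇̃_u (dφ V)` that is normal to the
image of the tangent space of `M`. (Another extension `V` of `v` changes `∇̃_u (dφ V)` only by
a tangent vector.) -/
def secondFundamentalForm (g : Metric F P) (φ : M → P) (x : M) (u v : TangentSpace I x) :
    TangentSpace 𝓘(ℝ, F) (φ x) :=
  normalPart (fun a b => g.inner (φ x) a b) (tangentImage I φ x ⊤) (ambientDerivative I g φ x u v)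

end Submanifold

section WarpedProduct

variable {E₁ E₂ : Type*} [NormedAddCommGroup E₁] [NormedSpace ℝ E₁]
  [NormedAddCommGroup E₂] [NormedSpace ℝ E₂]
  {N₁ N₂ : Type*} [TopologicalSpace N₁] [ChartedSpace E₁ N₁] [IsManifold 𝓘(ℝ, E₁) ∞ N₁]
  [TopologicalSpace N₂] [ChartedSpace E₂ N₂] [IsManifold 𝓘(ℝ, E₂) ∞ N₂]
  {F : Type*} [NormedAddCommGroup F] [NormedSpace ℝ F]
  {P : Type*} [TopologicalSpace P] [ChartedSpace F P] [IsManifold 𝓘(ℝ, F) ∞ P]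

variable (E₁ E₂) in
/-- The tangent space of the product manifold `N₁ × N₂` at `x`. -/
abbrev ProdTangent (x : N₁ × N₂) : Type _ :=
  TangentSpace (𝓘(ℝ, E₁).prod 𝓘(ℝ, E₂)) x

/-- The differential of the projection to `N₁`. -/
def dπ₁ (x : N₁ × N₂) : ProdTangent E₁ E₂ x →L[ℝ] TangentSpace 𝓘(ℝ, E₁) x.1 :=
  mfderiv (𝓘(ℝ, E₁).prod 𝓘(ℝ, E₂)) 𝓘(ℝ, E₁) Prod.fst x

/-- The differential of the projection to `N₂`. -/
def dπ₂ (x : N₁ × N₂) : ProdTangent E₁ E₂ x →L[ℝ] TangentSpace 𝓘(ℝ, E₂) x.2 :=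
  mfderiv (𝓘(ℝ, E₁).prod 𝓘(ℝ, E₂)) 𝓘(ℝ, E₂) Prod.snd x

variable (E₁ E₂) in
/-- The distribution `𝔇₁` on `N₁ × N₂`: vectors tangent to the leaves `N₁ × {y}`. -/
def distribution₁ (x : N₁ × N₂) : Submodule ℝ (ProdTangent E₁ E₂ x) :=
  LinearMap.ker (dπ₂ x).toLinearMap

variable (E₁ E₂) in
/-- The distribution `𝔇₂` on `N₁ × N₂`: vectors tangent to the fibers `{x} × N₂`. -/
def distribution₂ (x : N₁ × N₂) : Submodule ℝ (ProdTangent E₁ E₂ x) :=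
  LinearMap.ker (dπ₁ x).toLinearMap

/-- The warped product metric `g₁ + f² g₂` on `N₁ × N₂`. -/
def warpedMetric (g₁ : Metric E₁ N₁) (g₂ : Metric E₂ N₂) (f : N₁ → ℝ) (x : N₁ × N₂)
    (u v : ProdTangent E₁ E₂ x) : ℝ :=
  g₁.inner x.1 (dπ₁ x u) (dπ₁ x v) + f x.1 ^ 2 * g₂.inner x.2 (dπ₂ x u) (dπ₂ x v)

/-- `φ` is a (smooth) isometric immersion of the warped product `N₁ ×_f N₂` into `(P, g)`. -/
def IsIsometricImmersion (g₁ : Metric E₁ N₁) (g₂ : Metric E₂ N₂) (f : N₁ → ℝ) (g : Metric F P)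
    (φ : N₁ × N₂ → P) : Prop :=
  ContMDiff (𝓘(ℝ, E₁).prod 𝓘(ℝ, E₂)) 𝓘(ℝ, F) ∞ φ ∧
  ∀ (x : N₁ × N₂) (u v : ProdTangent E₁ E₂ x),
    g.inner (φ x) (mfderiv (𝓘(ℝ, E₁).prod 𝓘(ℝ, E₂)) 𝓘(ℝ, F) φ x u)
      (mfderiv (𝓘(ℝ, E₁).prod 𝓘(ℝ, E₂)) 𝓘(ℝ, F) φ x v) = warpedMetric g₁ g₂ f x u v

/-- The partial mean curvature vector `(1 / dim D) ∑ a, h(e_a, e_a)` at `x`, where `e` is an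
orthonormal basis of the subspace `D` of the tangent space of `N₁ ×_f N₂` at `x`. -/
def partialMeanCurvature (g₁ : Metric E₁ N₁) (g₂ : Metric E₂ N₂) (f : N₁ → ℝ) (g : Metric F P)
    (φ : N₁ × N₂ → P) (x : N₁ × N₂) (D : Submodule ℝ (ProdTangent E₁ E₂ x)) :
    TangentSpace 𝓘(ℝ, F) (φ x) :=
  (1 / (Module.finrank ℝ D : ℝ)) • ∑ a,
    secondFundamentalForm (𝓘(ℝ, E₁).prod 𝓘(ℝ, E₂)) g φ x
      (orthonormalFrame (warpedMetric g₁ g₂ f x) D a)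
      (orthonormalFrame (warpedMetric g₁ g₂ f x) D a)

/-- `φ` is `𝔇`-minimal: it is `𝔇₁`-minimal or `𝔇₂`-minimal, that is, the partial mean curvature
vector of one of the two distributions vanishes identically. -/
def IsDMinimal (g₁ : Metric E₁ N₁) (g₂ : Metric E₂ N₂) (f : N₁ → ℝ) (g : Metric F P)
    (φ : N₁ × N₂ → P) : Prop :=
  (∀ x, partialMeanCurvature g₁ g₂ f g φ x (distribution₁ E₁ E₂ x) = 0) ∨
  (∀ x, partialMeanCurvature g₁ g₂ f g φ x (distribution₂ E₁ E₂ x) = 0)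

/-- `‖h(𝔇₁, 𝔇₂)‖² = ∑ a, ∑ A, ‖h(e_a, e_A)‖²` at `x`, where `(e_a)` and `(e_A)` are orthonormal
bases of `𝔇₁` and `𝔇₂` at `x`. -/
def mixedNormSq (g₁ : Metric E₁ N₁) (g₂ : Metric E₂ N₂) (f : N₁ → ℝ) (g : Metric F P)
    (φ : N₁ × N₂ → P) (x : N₁ × N₂) : ℝ :=
  ∑ a, ∑ b,
    let h := secondFundamentalForm (𝓘(ℝ, E₁).prod 𝓘(ℝ, E₂)) g φ x
      (orthonormalFrame (warpedMetric g₁ g₂ f x) (distribution₁ E₁ E₂ x) a)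
      (orthonormalFrame (warpedMetric g₁ g₂ f x) (distribution₂ E₁ E₂ x) b)
    g.inner (φ x) h h

end WarpedProduct

end WarpedChen

end

noncomputable section

namespace WarpedChen

/-! ### Orthonormal frames, traces and normal parts. -/

section Frames

variable {V : Type*} [AddCommGroup V] [Module ℝ V]

/-! The theorem is the Gauss equation summed over all planes spanned by one leaf vector and one
fiber vector. For `u` in `𝔇₁` and `v` in `𝔇₂`, the mixed curvature of a warped product depends on
`f` alone, and the Gauss equation reads `R̃(u,v,v,u) + ⟨h(u,u), h(v,v)⟩ - |h(u,v)|² = ((∇_u u) f - u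
u f) / f * |v|²`, which is `IsIsometricImmersion.gauss_mixed`. Summing over orthonormal frames of
`𝔇₁` and `𝔇₂`, the first term gives the ambient scalar curvature of the whole tangent space minus
those of the two factors, and the right side gives `n₂ Δf / f`. The second term becomes the product
of the traces of `h` on the two distributions; one trace is zero by minimality
(`IsDMinimal.sum_inner_eq_zero`).

The curvature of the warped product itself is never formed. In charts, differentiating `⟨dΦ(v),
dΦ(w)⟩` twice expresses the ambient curvature and products of covariant Hessians of `Φ` through
second derivatives of the induced metric (`IsLeviCivitaAt.gauss`). For a warped metric these
derivatives are explicit. The Koszul formula gives the tangential parts of the Hessian, `∇_u u` from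
the leaf and `(u f / f) v` for a mixed pair (`IsLeviCivitaAt.covHess_leaf`,
`IsLeviCivitaAt.covHess_mixed`), and removing them turns Hessians into second fundamental forms
(`IsLeviCivitaAt.gauss_warped`).

The definitions use chosen frames. Frame independence comes from invariance of traces of bilinear
forms (`IsOrthonormalFrame.sum_eq_sum`), applied to the curvature in `two_mul_scalarCurvature` and
to the Hessian of `f` in `laplacian_eq_sum`. -/

theorem IsOrthonormalFrame.mem {B : V → V → ℝ} {L : Submodule ℝ V} {ι : Type*} [DecidableEq ι]
    {e : ι → V} (h : IsOrthonormalFrame B L e) (i : ι) : e i ∈ L :=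
  h.2 ▸ Submodule.subset_span ⟨i, rfl⟩

/-- Expansion of a vector in an orthonormal frame. -/
theorem IsOrthonormalFrame.sum_smul {B : V →ₗ[ℝ] V →ₗ[ℝ] ℝ} {L : Submodule ℝ V} {ι : Type*}
    [DecidableEq ι] [Fintype ι] {e : ι → V} (h : IsOrthonormalFrame (fun u v => B u v) L e)
    {w : V} (hw : w ∈ L) : ∑ i, B w (e i) • e i = w := by
  rw [← h.2] at hw
  induction hw using Submodule.span_induction with
  | mem x hx =>
    obtain ⟨j, rfl⟩ := hx
    have h1 : ∀ i, B (e j) (e i) = if j = i then 1 else 0 := h.1 j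
    simp [h1]
  | zero => simp
  | add x y _ _ hx hy => simp only [map_add, LinearMap.add_apply, add_smul,
      Finset.sum_add_distrib, hx, hy]
  | smul a x _ hx => simp only [map_smul, LinearMap.smul_apply, smul_eq_mul, mul_smul,
      ← Finset.smul_sum, hx]

/-- The trace of a bilinear form over an orthonormal frame does not depend on the frame. -/
theorem IsOrthonormalFrame.sum_eq_sum {B : V →ₗ[ℝ] V →ₗ[ℝ] ℝ} (hs : ∀ u v, B u v = B v u)
    {L : Submodule ℝ V} {ι κ : Type*} [DecidableEq ι] [Fintype ι] [DecidableEq κ] [Fintype κ]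
    {e : ι → V} {e' : κ → V} (h : IsOrthonormalFrame (fun u v => B u v) L e)
    (h' : IsOrthonormalFrame (fun u v => B u v) L e') (Q : V →ₗ[ℝ] V →ₗ[ℝ] ℝ) :
    ∑ i, Q (e i) (e i) = ∑ j, Q (e' j) (e' j) := by
  -- Expanding one argument in the other frame, on each side, gives the same double sum of `B (e i)
  -- (e' j) * Q (e i) (e' j)`, up to the symmetry of `B`.
  have h1 : ∀ i, Q (e i) (e i) = ∑ j, B (e i) (e' j) * Q (e i) (e' j) := fun i => by
    conv_lhs => rw [← h'.sum_smul (h.mem i)]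
    rw [h'.sum_smul (h.mem i)]
    conv_lhs => enter [2]; rw [← h'.sum_smul (h.mem i)]
    simp
  have h2 : ∀ j, Q (e' j) (e' j) = ∑ i, B (e' j) (e i) * Q (e i) (e' j) := fun j => by
    have := congrArg (fun w => Q w (e' j)) (h.sum_smul (h'.mem j))
    simpa using this.symm
  simp_rw [h1, h2]
  rw [Finset.sum_comm]
  simp_rw [hs]

/-- The normal part of `w` is `w - t` when `t` is tangent and `w - t` is orthogonal. -/
theorem normalPart_eq_sub {B : V →ₗ[ℝ] V →ₗ[ℝ] ℝ} (hs : ∀ u v, B u v = B v u)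
    (hp : ∀ v, v ≠ 0 → 0 < B v v) (L : Submodule ℝ V) [FiniteDimensional ℝ L] {w t : V}
    (ht : t ∈ L) (hwt : ∀ l ∈ L, B w l = B t l) :
    normalPart (fun u v => B u v) L w = w - t := by
  have h := isOrthonormalFrame_orthonormalFrame B hs hp L
  rw [normalPart]
  congr 1
  conv_rhs => rw [← h.sum_smul ht]
  exact Finset.sum_congr rfl fun i _ => by rw [hwt _ (h.mem i)]

/-- A normal part is orthogonal to the subspace. -/
theorem normalPart_orthogonal {B : V →ₗ[ℝ] V →ₗ[ℝ] ℝ} (hs : ∀ u v, B u v = B v u)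
    (hp : ∀ v, v ≠ 0 → 0 < B v v) (L : Submodule ℝ V) [FiniteDimensional ℝ L] (w : V) {l : V}
    (hl : l ∈ L) : B (normalPart (fun u v => B u v) L w) l = 0 := by
  have h := isOrthonormalFrame_orthonormalFrame B hs hp L
  rw [normalPart, map_sub, LinearMap.sub_apply, map_sum, LinearMap.sum_apply, sub_eq_zero]
  conv_lhs => rw [← h.sum_smul hl, map_sum]
  refine Finset.sum_congr rfl fun i _ => ?_
  simp only [map_smul, LinearMap.smul_apply, smul_eq_mul]
  rw [hs l, mul_comm]

/-- An isometric linear map carries orthonormal frames to orthonormal frames. -/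
theorem IsOrthonormalFrame.map {W : Type*} [AddCommGroup W] [Module ℝ W] {B : V → V → ℝ}
    {B' : W → W → ℝ} {L : Submodule ℝ V} {ι : Type*} [DecidableEq ι] {e : ι → V}
    (h : IsOrthonormalFrame B L e) (T : V →ₗ[ℝ] W)
    (hT : ∀ u ∈ L, ∀ v ∈ L, B' (T u) (T v) = B u v) :
    IsOrthonormalFrame B' (L.map T) (fun i => T (e i)) := by
  refine ⟨fun i j => by rw [hT _ (h.mem i) _ (h.mem j), h.1 i j], ?_⟩
  have : (fun i => T (e i)) = T ∘ e := rfl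
  rw [this, Set.range_comp, Submodule.span_image, h.2]

/-- Orthonormal frames of two orthogonal subspaces form one of their sum. -/
theorem IsOrthonormalFrame.sumElim {B : V → V → ℝ} {L L' : Submodule ℝ V} {ι κ : Type*}
    [DecidableEq ι] [DecidableEq κ] {e : ι → V} {e' : κ → V} (h : IsOrthonormalFrame B L e)
    (h' : IsOrthonormalFrame B L' e') (hl : ∀ u ∈ L, ∀ v ∈ L', B u v = 0 ∧ B v u = 0) :
    IsOrthonormalFrame B (L ⊔ L') (Sum.elim e e') := by
  constructor
  · rintro (i | i) (j | j)
    · simpa using h.1 i j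
    · simpa using (hl _ (h.mem i) _ (h'.mem j)).1
    · simpa using (hl _ (h.mem j) _ (h'.mem i)).2
    · simpa using h'.1 i j
  · rw [Set.Sum.elim_range, Submodule.span_union, h.2, h'.2]

/-- Twice the sum over `i < j` of a symmetric function that vanishes on the diagonal. -/
theorem two_mul_sum_Ioi {n : ℕ} (k : Fin n → Fin n → ℝ) (hs : ∀ i j, k i j = k j i)
    (h0 : ∀ i, k i i = 0) :
    2 * ∑ i, ∑ j ∈ Finset.Ioi i, k i j = ∑ i, ∑ j, k i j := by
  have h1 : ∀ i, ∑ j, k i j = ∑ j ∈ Finset.Ioi i, k i j + ∑ j ∈ Finset.Iio i, k i j := by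
    intro i
    rw [← Finset.sum_add_sum_compl (Finset.Ioi i), add_right_inj]
    have : (Finset.Ioi i)ᶜ = insert i (Finset.Iio i) := by
      ext j; simp [le_iff_eq_or_lt]
    rw [this, Finset.sum_insert (by simp), h0, zero_add]
  have h2 : ∑ i, ∑ j ∈ Finset.Iio i, k i j = ∑ i, ∑ j ∈ Finset.Ioi i, k i j := by
    rw [Finset.sum_comm' (t' := Finset.univ) (s' := fun j => Finset.Ioi j) (by simp)]
    exact Finset.sum_congr rfl fun i _ => Finset.sum_congr rfl fun j _ => hs j i
  simp_rw [h1]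
  rw [Finset.sum_add_distrib, h2, two_mul]

end Frames

set_option synthInstance.maxHeartbeats 200000

/-! ### Normed structures on spaces of bilinear and trilinear maps. -/

section Instances

variable {X Y Z W : Type*} [NormedAddCommGroup X] [NormedSpace ℝ X] [NormedAddCommGroup Y]
  [NormedSpace ℝ Y] [NormedAddCommGroup Z] [NormedSpace ℝ Z] [NormedAddCommGroup W]
  [NormedSpace ℝ W]

instance normedAddCommGroupBilin : NormedAddCommGroup (X →L[ℝ] Y →L[ℝ] Z) := inferInstance

instance normedSpaceBilin : NormedSpace ℝ (X →L[ℝ] Y →L[ℝ] Z) := inferInstance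

instance normedAddCommGroupTrilin : NormedAddCommGroup (X →L[ℝ] Y →L[ℝ] Z →L[ℝ] W) :=
  inferInstance

instance normedSpaceTrilin : NormedSpace ℝ (X →L[ℝ] Y →L[ℝ] Z →L[ℝ] W) := inferInstance

end Instances

/-! ### Levi-Civita connections in coordinates, covariant derivatives along a map, and the Gauss
equation. -/

section LeviCivita

open Filter Topology

variable {F : Type*} [NormedAddCommGroup F] [NormedSpace ℝ F]

/-- `Γ` is, near `q`, a smooth torsion free connection that is compatible with the smooth
metric `G`. -/
structure IsLeviCivitaAt (G : F → F →L[ℝ] F →L[ℝ] ℝ) (Γ : F → F →L[ℝ] F →L[ℝ] F) (q : F) :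
    Prop where
  contDiffAt_metric : ContDiffAt ℝ ∞ G q
  contDiffAt : ContDiffAt ℝ ∞ Γ q
  symm : ∀ᶠ y in 𝓝 q, ∀ u v, G y u v = G y v u
  torsionFree : ∀ᶠ y in 𝓝 q, ∀ u v, Γ y u v = Γ y v u
  compat : ∀ᶠ y in 𝓝 q, ∀ u v w, fderiv ℝ G y u v w = G y (Γ y u v) w + G y v (Γ y u w)

/-- The Christoffel symbols as a continuous bilinear map. -/
def christoffelCLM (G : F → F →L[ℝ] F →L[ℝ] ℝ) (z : F) : F →L[ℝ] F →L[ℝ] F :=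
  (ContinuousLinearMap.compL ℝ F (F →L[ℝ] ℝ) F (G z).inverse).comp ((1 / 2 : ℝ) •
    (fderiv ℝ G z + (fderiv ℝ G z).flip
      - (ContinuousLinearMap.flipₗᵢ ℝ F F ℝ).toContinuousLinearEquiv.toContinuousLinearMap.comp
          (fderiv ℝ G z).flip))

theorem christoffelCLM_apply (G : F → F →L[ℝ] F →L[ℝ] ℝ) (z u v : F) :
    christoffelCLM G z u v = christoffel G z u v := rfl

/-- A linear map on a finite-dimensional space depends linearly on its values on a basis, so
smoothness can be tested on fixed vectors. -/
theorem contDiffAt_of_clm_apply {D X Y : Type*} [NormedAddCommGroup D] [NormedSpace ℝ D]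
    [NormedAddCommGroup X] [NormedSpace ℝ X] [FiniteDimensional ℝ X] [NormedAddCommGroup Y]
    [NormedSpace ℝ Y] {n : ℕ∞ω} {k : D → X →L[ℝ] Y} {x : D}
    (h : ∀ v, ContDiffAt ℝ n (fun y => k y v) x) : ContDiffAt ℝ n k x := by
  let e₁ := ContinuousLinearEquiv.ofFinrankEq
    (Module.finrank_fin_fun ℝ (n := Module.finrank ℝ X)).symm
  let e₂ := (e₁.arrowCongr (.refl ℝ Y)).trans (ContinuousLinearEquiv.piRing _)
  rw [← Function.id_comp k, ← e₂.symm_comp_self, Function.comp_assoc]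
  exact e₂.symm.contDiff.contDiffAt.comp x (contDiffAt_pi.mpr fun _ => h _)

/-- Definiteness makes the map into the dual injective, and the dimensions agree. -/
theorem isInvertible_of_pos [FiniteDimensional ℝ F] (B : F →L[ℝ] F →L[ℝ] ℝ)
    (hp : ∀ v, v ≠ 0 → 0 < B v v) : B.IsInvertible := by
  have hinj : Function.Injective B := by
    rw [injective_iff_map_eq_zero]
    intro v hv
    by_contra h
    have := hp v h
    simp [hv] at this
  have hd : Module.finrank ℝ F = Module.finrank ℝ (F →L[ℝ] ℝ) := by
    rw [← (LinearMap.toContinuousLinearMap (𝕜 := ℝ) (E := F) (F' := ℝ)).finrank_eq]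
    exact (Subspace.dual_finrank_eq (K := ℝ) (V := F)).symm
  exact ⟨(LinearEquiv.ofInjectiveOfFinrankEq B.toLinearMap hinj hd).toContinuousLinearEquiv,
    by ext; rfl⟩

/-- The Christoffel symbols of a metric form its Levi-Civita connection. -/
theorem isLeviCivitaAt_christoffelCLM [FiniteDimensional ℝ F] {G : F → F →L[ℝ] F →L[ℝ] ℝ} {q : F}
    (hG : ContDiffAt ℝ ∞ G q) (hs : ∀ᶠ y in 𝓝 q, ∀ u v, G y u v = G y v u)
    (hp : ∀ᶠ y in 𝓝 q, ∀ v, v ≠ 0 → 0 < G y v v) :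
    IsLeviCivitaAt G (christoffelCLM G) q := by
  have : CompleteSpace F := FiniteDimensional.complete ℝ F
  have hd : ∀ᶠ y in 𝓝 q, DifferentiableAt ℝ G y := by
    have h1 : ContDiffAt ℝ 1 G q := hG.of_le (by simp)
    filter_upwards [h1.eventually (by simp)] with y hy using hy.differentiableAt (by simp)
  have hds : ∀ᶠ y in 𝓝 q, ∀ u v w, fderiv ℝ G y u v w = fderiv ℝ G y u w v := by
    filter_upwards [hs.eventually_nhds, hd] with y hy hdy u v w
    have e : (fun y => G y v w) =ᶠ[𝓝 y] fun y => G y w v := hy.mono fun _ h => h v w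
    have h2 := congrArg (fun l : F →L[ℝ] ℝ => l u) e.fderiv_eq
    have key : ∀ a b, fderiv ℝ (fun y => G y a b) y u = fderiv ℝ G y u a b := fun a b => by
      rw [fderiv_clm_apply (hdy.clm_apply (differentiableAt_const a)) (differentiableAt_const b),
        fderiv_clm_apply hdy (differentiableAt_const a)]
      simp
    simpa [key] using h2
  -- Positivity enters here: `inverse` is zero on non-invertible maps, so it undoes `G y` only where
  -- the metric is nondegenerate.
  have hk : ∀ᶠ y in 𝓝 q, ∀ u v w, G y (christoffelCLM G y u v) w =
      (1 / 2) * (fderiv ℝ G y u v w + fderiv ℝ G y v u w - fderiv ℝ G y w u v) := by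
    filter_upwards [hp] with y hy u v w
    rw [christoffelCLM_apply, christoffel, (isInvertible_of_pos _ hy).self_apply_inverse]
    simp
  refine ⟨hG, ?_, hs, ?_, ?_⟩
  · have h1 : ContDiffAt ℝ ∞ (fderiv ℝ G) q := hG.fderiv_right (by simp)
    have h2 : ContDiffAt ℝ ∞ (fun z => (G z).inverse) q :=
      ContDiffAt.comp q (isInvertible_of_pos _ hp.self_of_nhds).contDiffAt_map_inverse hG
    have h3 : ∀ u v w, ContDiffAt ℝ ∞ (fun z => fderiv ℝ G z u v w) q := fun u v w =>
      ((h1.clm_apply contDiffAt_const).clm_apply contDiffAt_const).clm_apply contDiffAt_const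
    refine contDiffAt_of_clm_apply fun u => contDiffAt_of_clm_apply fun v => ?_
    refine h2.clm_apply (contDiffAt_of_clm_apply fun w => ?_)
    exact contDiffAt_const.mul (((h3 u v w).add (h3 v u w)).sub (h3 w u v))
  · filter_upwards [hp, hds] with y hy hdy u v
    rw [christoffelCLM_apply, christoffelCLM_apply, christoffel, christoffel]
    congr 2
    ext w
    simp only [add_apply, sub_apply,
      ContinuousLinearMap.flip_apply]
    rw [hdy w u v]
    ring
  · filter_upwards [hk, hs, hds] with y hy hsy hdy u v w
    rw [hsy v, hy, hy, hdy u w v, hdy w u v]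
    ring

/-- The Koszul formula for a Levi-Civita connection. -/
theorem IsLeviCivitaAt.koszul_const {G : F → F →L[ℝ] F →L[ℝ] ℝ}
    {Γ : F → F →L[ℝ] F →L[ℝ] F} {q : F} (h : IsLeviCivitaAt G Γ q) (u v w : F) :
    G q (Γ q u v) w = (1 / 2) * (fderiv ℝ G q u v w + fderiv ℝ G q v u w
      - fderiv ℝ G q w u v) := by
  have hs := h.symm.self_of_nhds
  have ht := h.torsionFree.self_of_nhds
  rw [h.compat.self_of_nhds, h.compat.self_of_nhds, h.compat.self_of_nhds, ht v u, ht w u,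
    ht w v, hs v (Γ q u w), hs u (Γ q v w)]
  ring

variable {E : Type*} [NormedAddCommGroup E] [NormedSpace ℝ E]

/-- The covariant derivative, along the map `Φ`, of the vector field `Y` along `Φ`. -/
def covDeriv (Γ : F → F →L[ℝ] F →L[ℝ] F) (Φ Y : E → F) (y u : E) : F :=
  fderiv ℝ Y y u + Γ (Φ y) (fderiv ℝ Φ y u) (Y y)

/-- The pull-back of the metric `G` by `Φ`. -/
def pullbackMetric (G : F → F →L[ℝ] F →L[ℝ] ℝ) (Φ : E → F) (y u v : E) : ℝ :=
  G (Φ y) (fderiv ℝ Φ y u) (fderiv ℝ Φ y v)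

variable {G : F → F →L[ℝ] F →L[ℝ] ℝ} {Γ : F → F →L[ℝ] F →L[ℝ] F} {Φ : E → F} {z : E}

/-- The derivative along `v` of the field `dΦ(w)`. -/
abbrev covHess (Γ : F → F →L[ℝ] F →L[ℝ] F) (Φ : E → F) (y v w : E) : F :=
  covDeriv Γ Φ (fun y => fderiv ℝ Φ y w) y v

theorem eventually_differentiableAt {X Y : Type*} [NormedAddCommGroup X] [NormedSpace ℝ X]
    [NormedAddCommGroup Y] [NormedSpace ℝ Y] {k : X → Y} {x : X} (h : ContDiffAt ℝ ∞ k x) :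
    ∀ᶠ y in 𝓝 x, DifferentiableAt ℝ k y := by
  have h1 : ContDiffAt ℝ 1 k x := h.of_le (by simp)
  filter_upwards [h1.eventually (by simp)] with y hy using hy.differentiableAt (by simp)

theorem fderiv_apply_const {X Y Z : Type*} [NormedAddCommGroup X] [NormedSpace ℝ X]
    [NormedAddCommGroup Y] [NormedSpace ℝ Y] [NormedAddCommGroup Z] [NormedSpace ℝ Z]
    {k : X → Y →L[ℝ] Z} {x : X} (h : DifferentiableAt ℝ k x) (w : Y) (u : X) :
    fderiv ℝ (fun y => k y w) x u = fderiv ℝ k x u w := by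
  rw [fderiv_clm_apply h (differentiableAt_const w)]
  simp

/-- Compatibility of the connection and the metric along a map. -/
theorem IsLeviCivitaAt.eventually_fderiv_inner (h : IsLeviCivitaAt G Γ (Φ z))
    (hΦ : ContDiffAt ℝ ∞ Φ z) :
    ∀ᶠ y in 𝓝 z, ∀ (Y Z : E → F), DifferentiableAt ℝ Y y → DifferentiableAt ℝ Z y → ∀ u,
      fderiv ℝ (fun y => G (Φ y) (Y y) (Z y)) y u =
        G (Φ y) (covDeriv Γ Φ Y y u) (Z y) + G (Φ y) (Y y) (covDeriv Γ Φ Z y u) := by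
  filter_upwards [eventually_differentiableAt hΦ,
    hΦ.continuousAt.eventually (eventually_differentiableAt h.contDiffAt_metric),
    hΦ.continuousAt.eventually h.compat] with y h1 h2 h3 Y Z hY hZ u
  have h4 : DifferentiableAt ℝ (fun y => G (Φ y)) y := h2.comp y h1
  have h5 : fderiv ℝ (fun y => G (Φ y)) y u = fderiv ℝ G (Φ y) (fderiv ℝ Φ y u) := by
    rw [fderiv_fun_comp y h2 h1]; rfl
  rw [fderiv_clm_apply (h4.clm_apply hY) hZ, fderiv_clm_apply h4 hY]
  simp only [add_apply, ContinuousLinearMap.comp_apply,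
    ContinuousLinearMap.flip_apply, h5, h3, covDeriv, map_add]
  ring

/-- Both summands are symmetric: the second derivative of `Φ`, and `Γ` because it is torsion free.
-/
theorem IsLeviCivitaAt.eventually_covHess_symm (h : IsLeviCivitaAt G Γ (Φ z))
    (hΦ : ContDiffAt ℝ ∞ Φ z) :
    ∀ᶠ y in 𝓝 z, ∀ u v, covHess Γ Φ y u v = covHess Γ Φ y v u := by
  have h1 : ContDiffAt ℝ 2 Φ z := hΦ.of_le (by norm_cast)
  have h2 : ContDiffAt ℝ ∞ (fderiv ℝ Φ) z := hΦ.fderiv_right (by simp)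
  filter_upwards [h1.eventually (by norm_num), hΦ.continuousAt.eventually h.torsionFree,
    eventually_differentiableAt h2] with y h3 h4 h5 u v
  have h6 : fderiv ℝ (fderiv ℝ Φ) y u v = fderiv ℝ (fderiv ℝ Φ) y v u :=
    h3.isSymmSndFDerivAt (by simp) u v
  simp only [covHess, covDeriv]
  rw [fderiv_apply_const h5, fderiv_apply_const h5, h6, h4]

/-- Metric compatibility for the fields `dΦ(v)` and `dΦ(w)`. It is needed on a neighborhood because
the Gauss equation differentiates it once more. -/
theorem IsLeviCivitaAt.eventually_fderiv_pullbackMetric (h : IsLeviCivitaAt G Γ (Φ z))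
    (hΦ : ContDiffAt ℝ ∞ Φ z) :
    ∀ᶠ y in 𝓝 z, ∀ u v w, fderiv ℝ (fun y => pullbackMetric G Φ y v w) y u =
        G (Φ y) (covHess Γ Φ y u v) (fderiv ℝ Φ y w)
          + G (Φ y) (fderiv ℝ Φ y v) (covHess Γ Φ y u w) := by
  have h2 : ContDiffAt ℝ ∞ (fderiv ℝ Φ) z := hΦ.fderiv_right (by simp)
  filter_upwards [h.eventually_fderiv_inner hΦ, eventually_differentiableAt h2] with y h3 h4 u v w
  exact h3 _ _ (h4.clm_apply (differentiableAt_const v)) (h4.clm_apply (differentiableAt_const w)) u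

/-- The Koszul formula along a map. -/
theorem IsLeviCivitaAt.koszul (h : IsLeviCivitaAt G Γ (Φ z)) (hΦ : ContDiffAt ℝ ∞ Φ z)
    (u v w : E) :
    G (Φ z) (covHess Γ Φ z u v) (fderiv ℝ Φ z w) =
      (1 / 2) * (fderiv ℝ (fun y => pullbackMetric G Φ y v w) z u
        + fderiv ℝ (fun y => pullbackMetric G Φ y u w) z v
        - fderiv ℝ (fun y => pullbackMetric G Φ y u v) z w) := by
  have h1 := (h.eventually_fderiv_pullbackMetric hΦ).self_of_nhds
  have h2 := (h.eventually_covHess_symm hΦ).self_of_nhds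
  have h3 := (hΦ.continuousAt.eventually h.symm).self_of_nhds
  rw [h1, h1, h1, h2 v u, h2 w u, h2 w v, h3 (fderiv ℝ Φ z v) (covHess Γ Φ z u w),
    h3 (fderiv ℝ Φ z u) (covHess Γ Φ z v w)]
  ring

theorem IsLeviCivitaAt.contDiffAt_covHess (h : IsLeviCivitaAt G Γ (Φ z))
    (hΦ : ContDiffAt ℝ ∞ Φ z) (v w : E) : ContDiffAt ℝ ∞ (fun y => covHess Γ Φ y v w) z := by
  have h1 : ContDiffAt ℝ ∞ (fderiv ℝ Φ) z := hΦ.fderiv_right (by simp)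
  have h2 : ∀ w, ContDiffAt ℝ ∞ (fun y => fderiv ℝ Φ y w) z := fun w =>
    h1.clm_apply contDiffAt_const
  have h3 : ContDiffAt ℝ ∞ (fun y => fderiv ℝ (fun y => fderiv ℝ Φ y w) y v) z :=
    ((h2 w).fderiv_right (m := ∞) (by simp)).clm_apply contDiffAt_const
  exact h3.add (((h.contDiffAt.comp z hΦ).clm_apply (h2 v)).clm_apply (h2 w))

/-- The commutator of covariant derivatives along a map is the curvature. -/
theorem IsLeviCivitaAt.covDeriv_covHess_sub (h : IsLeviCivitaAt G Γ (Φ z))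
    (hΦ : ContDiffAt ℝ ∞ Φ z) (hΓ : ∀ᶠ y in 𝓝 (Φ z), ∀ u v, christoffel G y u v = Γ y u v)
    (u v w : E) :
    covDeriv Γ Φ (fun y => covHess Γ Φ y v w) z u - covDeriv Γ Φ (fun y => covHess Γ Φ y u w) z v =
      localCurvature G (Φ z) (fderiv ℝ Φ z u) (fderiv ℝ Φ z v) (fderiv ℝ Φ z w) := by
  have h1 : ContDiffAt ℝ ∞ (fderiv ℝ Φ) z := hΦ.fderiv_right (by simp)
  have h2 : ContDiffAt ℝ ∞ (fderiv ℝ (fderiv ℝ Φ)) z := h1.fderiv_right (by simp)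
  have dΦ := (eventually_differentiableAt hΦ).self_of_nhds
  have d1 := (eventually_differentiableAt h1).self_of_nhds
  have d2 := (eventually_differentiableAt h2).self_of_nhds
  have dΓ := (eventually_differentiableAt h.contDiffAt).self_of_nhds
  have dΓΦ : DifferentiableAt ℝ (fun y => Γ (Φ y)) z := dΓ.comp z dΦ
  have d1' : ∀ w, DifferentiableAt ℝ (fun y => fderiv ℝ Φ y w) z := fun w =>
    d1.clm_apply (differentiableAt_const w)
  -- After antisymmetrization in `u` and `v`, the third derivatives of `Φ` and the terms with second
  -- derivatives cancel; the derivative of `Γ` and the products of `Γ` remain, which is the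
  -- curvature.
  have key : ∀ u v, fderiv ℝ (fun y => covHess Γ Φ y v w) z u =
      fderiv ℝ (fderiv ℝ (fderiv ℝ Φ)) z u v w
        + (fderiv ℝ Γ (Φ z) (fderiv ℝ Φ z u) (fderiv ℝ Φ z v) (fderiv ℝ Φ z w)
          + Γ (Φ z) (fderiv ℝ (fderiv ℝ Φ) z u v) (fderiv ℝ Φ z w)
          + Γ (Φ z) (fderiv ℝ Φ z v) (fderiv ℝ (fderiv ℝ Φ) z u w)) := by
    intro u v
    have e : (fun y => covHess Γ Φ y v w) =ᶠ[𝓝 z] fun y =>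
        fderiv ℝ (fderiv ℝ Φ) y v w + Γ (Φ y) (fderiv ℝ Φ y v) (fderiv ℝ Φ y w) := by
      filter_upwards [eventually_differentiableAt h1] with y hy
      simp only [covHess, covDeriv]
      rw [fderiv_apply_const hy]
    have d3 : DifferentiableAt ℝ (fun y => fderiv ℝ (fderiv ℝ Φ) y v) z :=
      d2.clm_apply (differentiableAt_const v)
    have d4 : DifferentiableAt ℝ (fun y => Γ (Φ y) (fderiv ℝ Φ y v)) z := dΓΦ.clm_apply (d1' v)
    have h5 : fderiv ℝ (fun y => Γ (Φ y)) z u = fderiv ℝ Γ (Φ z) (fderiv ℝ Φ z u) := by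
      rw [fderiv_fun_comp z dΓ dΦ]; rfl
    rw [e.fderiv_eq, fderiv_fun_add (d3.clm_apply (differentiableAt_const w))
      (d4.clm_apply (d1' w)), add_apply, fderiv_apply_const d3,
      fderiv_apply_const d2, fderiv_clm_apply d4 (d1' w), fderiv_clm_apply dΓΦ (d1' v)]
    simp only [add_apply, ContinuousLinearMap.comp_apply,
      ContinuousLinearMap.flip_apply, fderiv_apply_const d1, h5]
    abel
  have kR : ∀ a b c, fderiv ℝ (fun y => christoffel G y b c) (Φ z) a = fderiv ℝ Γ (Φ z) a b c := by
    intro a b c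
    have e : (fun y => christoffel G y b c) =ᶠ[𝓝 (Φ z)] fun y => Γ y b c :=
      hΓ.mono fun _ h => h b c
    rw [e.fderiv_eq, fderiv_apply_const (dΓ.clm_apply (differentiableAt_const b)),
      fderiv_apply_const dΓ]
  have hΓ0 := hΓ.self_of_nhds
  have s1 : ContDiffAt ℝ 2 (fderiv ℝ Φ) z := h1.of_le (by norm_cast)
  have s2 : ContDiffAt ℝ 2 Φ z := hΦ.of_le (by norm_cast)
  have s3 : fderiv ℝ (fderiv ℝ (fderiv ℝ Φ)) z u v = fderiv ℝ (fderiv ℝ (fderiv ℝ Φ)) z v u :=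
    s1.isSymmSndFDerivAt (by simp) u v
  have s4 : fderiv ℝ (fderiv ℝ Φ) z u v = fderiv ℝ (fderiv ℝ Φ) z v u :=
    s2.isSymmSndFDerivAt (by simp) u v
  rw [covDeriv, covDeriv, key, key, s3, s4, localCurvature, kR, kR]
  simp only [covHess, covDeriv, fderiv_apply_const d1, hΓ0, map_add]
  abel

/-- The Gauss equation in coordinates. -/
theorem IsLeviCivitaAt.gauss (h : IsLeviCivitaAt G Γ (Φ z))
    (hΦ : ContDiffAt ℝ ∞ Φ z) (hΓ : ∀ᶠ y in 𝓝 (Φ z), ∀ u v, christoffel G y u v = Γ y u v)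
    (u v : E) :
    G (Φ z) (localCurvature G (Φ z) (fderiv ℝ Φ z u) (fderiv ℝ Φ z v) (fderiv ℝ Φ z v))
        (fderiv ℝ Φ z u)
      + G (Φ z) (covHess Γ Φ z u u) (covHess Γ Φ z v v)
      - G (Φ z) (covHess Γ Φ z u v) (covHess Γ Φ z u v) =
    fderiv ℝ (fun y => fderiv ℝ (fun y => pullbackMetric G Φ y u v) y v) z u
      - (1 / 2) * fderiv ℝ (fun y => fderiv ℝ (fun y => pullbackMetric G Φ y v v) y u) z u
      - (1 / 2) * fderiv ℝ (fun y => fderiv ℝ (fun y => pullbackMetric G Φ y u u) y v) z v := by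
  have h1 : ContDiffAt ℝ ∞ (fderiv ℝ Φ) z := hΦ.fderiv_right (by simp)
  have d1 : ∀ w, DifferentiableAt ℝ (fun y => fderiv ℝ Φ y w) z := fun w =>
    (eventually_differentiableAt h1).self_of_nhds.clm_apply (differentiableAt_const w)
  have dB : ∀ u v, DifferentiableAt ℝ (fun y => covHess Γ Φ y u v) z := fun u v =>
    (eventually_differentiableAt (h.contDiffAt_covHess hΦ u v)).self_of_nhds
  have hs := (hΦ.continuousAt.eventually h.symm)
  have hsB := h.eventually_covHess_symm hΦ
  have hI := (h.eventually_fderiv_inner hΦ).self_of_nhds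
  have dG : DifferentiableAt ℝ (fun y => G (Φ y)) z :=
    ((eventually_differentiableAt h.contDiffAt_metric).self_of_nhds).comp z
      (eventually_differentiableAt hΦ).self_of_nhds
  -- Compatibility used twice. In the combination of second derivatives below, the third-order terms
  -- paired with `dΦ(v)` cancel, and those paired with `dΦ(u)` leave a commutator.
  have dd : ∀ a b c d, fderiv ℝ (fun y => fderiv ℝ (fun y => pullbackMetric G Φ y c d) y b) z a =
      G (Φ z) (covDeriv Γ Φ (fun y => covHess Γ Φ y b c) z a) (fderiv ℝ Φ z d)
      + G (Φ z) (covHess Γ Φ z b c) (covHess Γ Φ z a d)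
      + (G (Φ z) (covHess Γ Φ z a c) (covHess Γ Φ z b d)
      + G (Φ z) (fderiv ℝ Φ z c) (covDeriv Γ Φ (fun y => covHess Γ Φ y b d) z a)) := by
    intro a b c d
    have e : (fun y => fderiv ℝ (fun y => pullbackMetric G Φ y c d) y b) =ᶠ[𝓝 z] fun y =>
        G (Φ y) (covHess Γ Φ y b c) (fderiv ℝ Φ y d)
          + G (Φ y) (fderiv ℝ Φ y c) (covHess Γ Φ y b d) :=
      (h.eventually_fderiv_pullbackMetric hΦ).mono fun y hy => hy b c d
    rw [e.fderiv_eq, fderiv_fun_add ((dG.clm_apply (dB b c)).clm_apply (d1 d))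
      ((dG.clm_apply (d1 c)).clm_apply (dB b d)), add_apply,
      hI _ _ (dB b c) (d1 d), hI _ _ (d1 c) (dB b d)]
  have hs0 := hs.self_of_nhds
  have hB0 := hsB.self_of_nhds
  have e1 : covDeriv Γ Φ (fun y => covHess Γ Φ y v u) z =
      covDeriv Γ Φ (fun y => covHess Γ Φ y u v) z := by
    have e : (fun y => covHess Γ Φ y v u) =ᶠ[𝓝 z] fun y => covHess Γ Φ y u v :=
      hsB.mono fun y hy => hy v u
    ext t
    rw [covDeriv, covDeriv, e.fderiv_eq, hB0 v u]
  rw [← h.covDeriv_covHess_sub hΦ hΓ u v v, dd, dd, dd, e1, hB0 v u,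
    hs0 (fderiv ℝ Φ z v) _, hs0 (fderiv ℝ Φ z u) _, hs0 (fderiv ℝ Φ z u) _, map_sub,
    sub_apply]
  ring

/-- The curvature is symmetric under exchange of the two planes spanned by `u`, `v`. -/
theorem IsLeviCivitaAt.localCurvature_symm {G : F → F →L[ℝ] F →L[ℝ] ℝ}
    {Γ : F → F →L[ℝ] F →L[ℝ] F} {q : F} (h : IsLeviCivitaAt G Γ q)
    (hΓ : ∀ᶠ y in 𝓝 q, ∀ u v, christoffel G y u v = Γ y u v) (u v : F) :
    G q (localCurvature G q u v v) u = G q (localCurvature G q v u u) v := by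
  have hΦ : ContDiffAt ℝ ∞ (fun y : F => y) q := contDiffAt_id
  -- For the identity map the Gauss equation expresses the curvature by second derivatives of `G`
  -- and products of `Γ`; both are symmetric in `u` and `v`, so comparing the two orders suffices.
  have g1 := IsLeviCivitaAt.gauss (Φ := fun y => y) (z := q) h hΦ hΓ u v
  have g2 := IsLeviCivitaAt.gauss (Φ := fun y => y) (z := q) h hΦ hΓ v u
  have hB := (IsLeviCivitaAt.eventually_covHess_symm (Φ := fun y => y) h hΦ).self_of_nhds
  have hs := h.symm.self_of_nhds
  have hH : ContDiffAt ℝ ∞ (fun y => G y u v) q :=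
    (h.contDiffAt_metric.clm_apply contDiffAt_const).clm_apply contDiffAt_const
  have d1 : DifferentiableAt ℝ (fderiv ℝ fun y => G y u v) q :=
    (eventually_differentiableAt (hH.fderiv_right (m := ∞) (by simp))).self_of_nhds
  have h2 : ContDiffAt ℝ 2 (fun y => G y u v) q := hH.of_le (by norm_cast)
  have h3 : fderiv ℝ (fderiv ℝ fun y => G y u v) q u v =
      fderiv ℝ (fderiv ℝ fun y => G y u v) q v u :=
    h2.isSymmSndFDerivAt (by simp) u v
  have e : (fun y => fderiv ℝ (fun y => G y v u) y u) =ᶠ[𝓝 q]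
      fun y => fderiv ℝ (fun y => G y u v) y u := by
    filter_upwards [h.symm.eventually_nhds] with y hy
    have : (fun y => G y v u) =ᶠ[𝓝 y] fun y => G y u v := hy.mono fun y h => h v u
    rw [this.fderiv_eq]
  simp only [pullbackMetric, fderiv_fun_id, ContinuousLinearMap.id_apply] at g1 g2
  rw [e.fderiv_eq, fderiv_apply_const d1] at g2
  rw [fderiv_apply_const d1] at g1
  rw [hB v u, hs (covHess Γ (fun y => y) q v v)] at g2
  linarith

end LeviCivita

/-! ### Metrics and maps read in the preferred charts. -/

section Charts

open Filter Topology

variable {E : Type*} [NormedAddCommGroup E] [NormedSpace ℝ E]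
  {N : Type*} [TopologicalSpace N] [ChartedSpace E N] [IsManifold 𝓘(ℝ, E) ∞ N]

theorem contMDiffAt_extChartAt_symm_of_mem {H : Type*} [TopologicalSpace H]
    {I : ModelWithCorners ℝ E H} [I.Boundaryless] {M : Type*} [TopologicalSpace M]
    [ChartedSpace H M] [IsManifold I ∞ M] {p : M} {z : E} (hz : z ∈ (extChartAt I p).target) :
    ContMDiffAt 𝓘(ℝ, E) I ∞ (extChartAt I p).symm z :=
  (contMDiffOn_extChartAt_symm p z hz).contMDiffAt
    ((isOpen_extChartAt_target p).mem_nhds hz)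

/-- The tangent space at `p` is identified with `E` through the preferred chart at `p`, so that
chart has identity derivative there. -/
theorem mfderiv_extChartAt_symm_self (p : N) :
    mfderiv 𝓘(ℝ, E) 𝓘(ℝ, E) (extChartAt 𝓘(ℝ, E) p).symm (extChartAt 𝓘(ℝ, E) p p) =
      ContinuousLinearMap.id ℝ E := by
  have : IsManifold 𝓘(ℝ, E) 1 N := IsManifold.of_le (n := ∞) (by norm_cast)
  have h := mfderivWithin_range_extChartAt_symm (I := 𝓘(ℝ, E)) (x := p)
  rw [modelWithCornersSelf_coe, Set.range_id, mfderivWithin_univ] at h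
  exact h

theorem isInvertible_mfderiv_extChartAt_symm {p : N} {z : E}
    (hz : z ∈ (extChartAt 𝓘(ℝ, E) p).target) :
    (mfderiv 𝓘(ℝ, E) 𝓘(ℝ, E) (extChartAt 𝓘(ℝ, E) p).symm z).IsInvertible := by
  have : IsManifold 𝓘(ℝ, E) 1 N := IsManifold.of_le (n := ∞) (by norm_cast)
  have h := isInvertible_mfderivWithin_extChartAt_symm hz
  rw [modelWithCornersSelf_coe, Set.range_id, mfderivWithin_univ] at h
  exact h

theorem chartMetric_apply (g : Metric E N) (p : N) (z u v : E) :
    chartMetric g p z u v = g.inner ((extChartAt 𝓘(ℝ, E) p).symm z)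
      (mfderiv 𝓘(ℝ, E) 𝓘(ℝ, E) (extChartAt 𝓘(ℝ, E) p).symm z u)
      (mfderiv 𝓘(ℝ, E) 𝓘(ℝ, E) (extChartAt 𝓘(ℝ, E) p).symm z v) := rfl

theorem chartMetric_symm (g : Metric E N) (p : N) (z u v : E) :
    chartMetric g p z u v = chartMetric g p z v u := by
  rw [chartMetric_apply, chartMetric_apply, g.symm]

theorem chartMetric_pos (g : Metric E N) {p : N} {z : E}
    (hz : z ∈ (extChartAt 𝓘(ℝ, E) p).target) {v : E} (hv : v ≠ 0) :
    0 < chartMetric g p z v v := by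
  rw [chartMetric_apply]
  refine g.pos _ _ fun h0 => hv ?_
  obtain ⟨A, hA⟩ := isInvertible_mfderiv_extChartAt_symm hz
  rw [← hA] at h0
  exact A.injective (h0.trans (map_zero A).symm)

theorem chartMetric_self (g : Metric E N) (p : N) (u v : E) :
    chartMetric g p (extChartAt 𝓘(ℝ, E) p p) u v =
      g.inner p (u : TangentSpace 𝓘(ℝ, E) p) (v : TangentSpace 𝓘(ℝ, E) p) := by
  rw [chartMetric_apply, mfderiv_extChartAt_symm_self]
  -- The base point `ψ⁻¹(ψ p)` equals `p` only propositionally; reading both forms on `E` lets the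
  -- equality be substituted.
  have h : ∀ q : N, q = p → (g.inner q : E →L[ℝ] E →L[ℝ] ℝ) u v =
      (g.inner p : E →L[ℝ] E →L[ℝ] ℝ) u v := by
    rintro q rfl; rfl
  exact h _ (extChartAt_to_inv p)

/-- For fixed `u`, the vectors `dψ⁻¹(u)` form a smooth field along the inverse chart; evaluating the
smooth section `g` on two such fields gives a smooth function. -/
theorem contDiffAt_chartMetric [FiniteDimensional ℝ E] (g : Metric E N) {p : N} {z : E}
    (hz : z ∈ (extChartAt 𝓘(ℝ, E) p).target) : ContDiffAt ℝ ∞ (chartMetric g p) z := by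
  refine contDiffAt_of_clm_apply fun u => contDiffAt_of_clm_apply fun v => ?_
  have hψ := contMDiffAt_extChartAt_symm_of_mem (I := 𝓘(ℝ, E)) hz
  have hA : ∀ u : E, ContMDiffAt 𝓘(ℝ, E) (𝓘(ℝ, E).prod 𝓘(ℝ, E)) ∞ (fun y =>
      TotalSpace.mk' E (E := fun x : N => TangentSpace 𝓘(ℝ, E) x) ((extChartAt 𝓘(ℝ, E) p).symm y)
        (mfderiv 𝓘(ℝ, E) 𝓘(ℝ, E) (extChartAt 𝓘(ℝ, E) p).symm y u)) z := by
    intro u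
    have hm := hψ.mfderiv_const (m := ∞) (by simp)
    have hu : ContMDiffAt 𝓘(ℝ, E) (𝓘(ℝ, E).prod 𝓘(ℝ, E)) ∞ (fun y : E =>
        TotalSpace.mk' E (E := fun x : E => TangentSpace 𝓘(ℝ, E) x) y u) z :=
      (contMDiffAt_vectorSpace_iff_contDiffAt (V := fun _ : E => u)).2 contDiffAt_const
    exact ContMDiffAt.clm_apply_of_inCoordinates hm hu hψ
  have h := ContMDiffAt.clm_bundle_apply₂ (F₁ := E) (F₂ := E) (F₃ := ℝ)
    (E₃ := fun _ : N => ℝ)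
    (g.contMDiff.contMDiffAt.comp z hψ) (hA u) (hA v)
  rw [contMDiffAt_totalSpace] at h
  exact contMDiffAt_iff_contDiffAt.1 h.2

/-- The Christoffel symbols in the preferred chart are those of a Levi-Civita connection. -/
theorem isLeviCivitaAt_chartMetric [FiniteDimensional ℝ E] (g : Metric E N) {p : N} {z : E}
    (hz : z ∈ (extChartAt 𝓘(ℝ, E) p).target) :
    IsLeviCivitaAt (chartMetric g p) (christoffelCLM (chartMetric g p)) z :=
  isLeviCivitaAt_christoffelCLM (contDiffAt_chartMetric g hz)
    (.of_forall fun y u v => chartMetric_symm g p y u v)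
    (((isOpen_extChartAt_target p).eventually_mem hz).mono fun _ hy _ hv => chartMetric_pos g hy hv)

variable {H : Type*} [TopologicalSpace H]
  {I : ModelWithCorners ℝ E H} {M : Type*} [TopologicalSpace M] [ChartedSpace H M]
  {F : Type*} [NormedAddCommGroup F] [NormedSpace ℝ F]
  {P : Type*} [TopologicalSpace P] [ChartedSpace F P]

theorem writtenInExtChartAt_self (φ : M → P) (x : M) :
    writtenInExtChartAt I 𝓘(ℝ, F) x φ (extChartAt I x x) = extChartAt 𝓘(ℝ, F) (φ x) (φ x) := by
  simp [writtenInExtChartAt]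

variable [I.Boundaryless]

theorem contDiffAt_writtenInExtChartAt {φ : M → P} (hφ : ContMDiff I 𝓘(ℝ, F) ∞ φ) (x : M) :
    ContDiffAt ℝ ∞ (writtenInExtChartAt I 𝓘(ℝ, F) x φ) (extChartAt I x x) := by
  have h := (contMDiffAt_iff.1 (hφ x)).2
  rw [I.range_eq_univ, contDiffWithinAt_univ] at h
  exact h

theorem fderiv_writtenInExtChartAt {φ : M → P} (hφ : ContMDiff I 𝓘(ℝ, F) ∞ φ) (x : M) :
    fderiv ℝ (writtenInExtChartAt I 𝓘(ℝ, F) x φ) (extChartAt I x x) = mfderiv I 𝓘(ℝ, F) φ x := by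
  have h := ((hφ x).mdifferentiableAt (by simp)).mfderiv
  rw [I.range_eq_univ, fderivWithin_univ] at h
  exact h.symm

variable [IsManifold I ∞ M] [IsManifold 𝓘(ℝ, F) ∞ P]

/-- The metric pulled back by `φ`, in charts. -/
theorem pullbackMetric_writtenInExtChartAt (g : Metric F P) {φ : M → P}
    (hφ : ContMDiff I 𝓘(ℝ, F) ∞ φ) (x : M) :
    ∀ᶠ z in 𝓝 (extChartAt I x x), ∀ u v : E,
      pullbackMetric (chartMetric g (φ x)) (writtenInExtChartAt I 𝓘(ℝ, F) x φ) z u v =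
        g.inner (φ ((extChartAt I x).symm z))
          (mfderiv I 𝓘(ℝ, F) φ ((extChartAt I x).symm z)
            (mfderiv 𝓘(ℝ, E) I (extChartAt I x).symm z u))
          (mfderiv I 𝓘(ℝ, F) φ ((extChartAt I x).symm z)
            (mfderiv 𝓘(ℝ, E) I (extChartAt I x).symm z v)) := by
  set ψ := extChartAt I x with hψ
  set χ := extChartAt 𝓘(ℝ, F) (φ x) with hχ
  set Φ := writtenInExtChartAt I 𝓘(ℝ, F) x φ with hΦ
  have h1 : ∀ᶠ z in 𝓝 (ψ x), z ∈ ψ.target :=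
    (isOpen_extChartAt_target x).eventually_mem (mem_extChartAt_target x)
  have hc : ContinuousAt (fun z => φ (ψ.symm z)) (ψ x) := by
    have := (contMDiffAt_extChartAt_symm_of_mem (I := I) (mem_extChartAt_target x)).continuousAt
    exact hφ.continuous.continuousAt.comp this
  have h2 : ∀ᶠ z in 𝓝 (ψ x), φ (ψ.symm z) ∈ χ.source := by
    refine hc.eventually ((isOpen_extChartAt_source (φ x)).eventually_mem ?_)
    have hx : ψ.symm (ψ x) = x := extChartAt_to_inv x
    change φ (ψ.symm (ψ x)) ∈ _
    rw [hx]
    exact mem_extChartAt_source _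
  filter_upwards [h1, h2.eventually_nhds,
    eventually_differentiableAt (contDiffAt_writtenInExtChartAt hφ x)] with z hz hφz hd u v
  have hz2 := hφz.self_of_nhds
  have e0 : ∀ y, φ (ψ.symm y) ∈ χ.source → χ.symm (Φ y) = φ (ψ.symm y) := fun y hy =>
    χ.left_inv hy
  -- Applying the chain rule to both sides of this identity compares the chart derivative of `Φ`
  -- with the differential of `φ`.
  have e : (χ.symm ∘ Φ) =ᶠ[𝓝 z] (φ ∘ ψ.symm) := hφz.mono e0
  have hΦz : Φ z ∈ χ.target := χ.map_source hz2
  have c1 : mfderiv 𝓘(ℝ, E) 𝓘(ℝ, F) (χ.symm ∘ Φ) z =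
      (mfderiv 𝓘(ℝ, F) 𝓘(ℝ, F) χ.symm (Φ z)).comp (mfderiv 𝓘(ℝ, E) 𝓘(ℝ, F) Φ z) :=
    mfderiv_comp z ((contMDiffAt_extChartAt_symm_of_mem hΦz).mdifferentiableAt (by simp))
      hd.mdifferentiableAt
  have c2 : mfderiv 𝓘(ℝ, E) 𝓘(ℝ, F) (φ ∘ ψ.symm) z =
      (mfderiv I 𝓘(ℝ, F) φ (ψ.symm z)).comp (mfderiv 𝓘(ℝ, E) I ψ.symm z) :=
    mfderiv_comp z ((hφ _).mdifferentiableAt (by simp))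
      ((contMDiffAt_extChartAt_symm_of_mem hz).mdifferentiableAt (by simp))
  have c3 : ∀ w : E, (mfderiv 𝓘(ℝ, F) 𝓘(ℝ, F) χ.symm (Φ z) (fderiv ℝ Φ z w) : F) =
      mfderiv I 𝓘(ℝ, F) φ (ψ.symm z) (mfderiv 𝓘(ℝ, E) I ψ.symm z w) := by
    intro w
    have c4 := e.mfderiv_eq (I := 𝓘(ℝ, E)) (I' := 𝓘(ℝ, F))
    rw [mfderiv_eq_fderiv] at c1
    have c5 := congrArg (fun A : E →L[ℝ] F => A w) c1
    have c6 := congrArg (fun A : E →L[ℝ] F => A w) c2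
    have c7 := congrArg (fun A : E →L[ℝ] F => A w) c4
    exact c5.symm.trans (c7.trans c6)
  have key : ∀ (q q' : P) (a b a' b' : F), q = q' → a = a' → b = b' →
      (g.inner q : F →L[ℝ] F →L[ℝ] ℝ) a b = (g.inner q' : F →L[ℝ] F →L[ℝ] ℝ) a' b' := by
    rintro q _ a b _ _ rfl rfl rfl; rfl
  exact key _ _ _ _ _ _ (e0 z hz2) (c3 u) (c3 v)

end Charts

/-! ### Warped product metrics in coordinates. -/

section LocalWarped

open Filter Topology

variable {E₁ E₂ : Type*} [NormedAddCommGroup E₁] [NormedSpace ℝ E₁]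
  [NormedAddCommGroup E₂] [NormedSpace ℝ E₂]

theorem fderiv_comp_fst_apply {k : E₁ → ℝ} {y : E₁ × E₂} (hk : DifferentiableAt ℝ k y.1)
    (u : E₁ × E₂) : fderiv ℝ (fun y : E₁ × E₂ => k y.1) y u = fderiv ℝ k y.1 u.1 := by
  have h : HasFDerivAt (fun y : E₁ × E₂ => k y.1) _ y := hk.hasFDerivAt.comp y hasFDerivAt_fst
  rw [h.fderiv]; rfl

theorem fderiv_comp_snd_apply {k : E₂ → ℝ} {y : E₁ × E₂} (hk : DifferentiableAt ℝ k y.2)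
    (u : E₁ × E₂) : fderiv ℝ (fun y : E₁ × E₂ => k y.2) y u = fderiv ℝ k y.2 u.2 := by
  have h : HasFDerivAt (fun y : E₁ × E₂ => k y.2) _ y := hk.hasFDerivAt.comp y hasFDerivAt_snd
  rw [h.fderiv]; rfl

/-- The warped product metric on a product of open subsets of vector spaces. -/
def localWarpedMetric (G₁ : E₁ → E₁ →L[ℝ] E₁ →L[ℝ] ℝ) (G₂ : E₂ → E₂ →L[ℝ] E₂ →L[ℝ] ℝ)
    (f : E₁ → ℝ) (y a b : E₁ × E₂) : ℝ :=
  G₁ y.1 a.1 b.1 + f y.1 ^ 2 * G₂ y.2 a.2 b.2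

variable {G₁ : E₁ → E₁ →L[ℝ] E₁ →L[ℝ] ℝ} {G₂ : E₂ → E₂ →L[ℝ] E₂ →L[ℝ] ℝ} {f : E₁ → ℝ}

theorem fderiv_localWarpedMetric {y : E₁ × E₂} (h₁ : DifferentiableAt ℝ G₁ y.1)
    (h₂ : DifferentiableAt ℝ G₂ y.2) (hf : DifferentiableAt ℝ f y.1) (a b u : E₁ × E₂) :
    fderiv ℝ (fun y => localWarpedMetric G₁ G₂ f y a b) y u =
      fderiv ℝ G₁ y.1 u.1 a.1 b.1 + 2 * (f y.1 * fderiv ℝ f y.1 u.1) * G₂ y.2 a.2 b.2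
        + f y.1 ^ 2 * fderiv ℝ G₂ y.2 u.2 a.2 b.2 := by
  have k₁ : DifferentiableAt ℝ (fun t => G₁ t a.1 b.1) y.1 :=
    (h₁.clm_apply (differentiableAt_const _)).clm_apply (differentiableAt_const _)
  have k₂ : DifferentiableAt ℝ (fun t => G₂ t a.2 b.2) y.2 :=
    (h₂.clm_apply (differentiableAt_const _)).clm_apply (differentiableAt_const _)
  have kf : DifferentiableAt ℝ (fun t => f t ^ 2) y.1 := hf.pow 2
  have l₁ : DifferentiableAt ℝ (fun y : E₁ × E₂ => G₁ y.1 a.1 b.1) y :=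
    k₁.comp y differentiableAt_fst
  have l₂ : DifferentiableAt ℝ (fun y : E₁ × E₂ => G₂ y.2 a.2 b.2) y :=
    k₂.comp y differentiableAt_snd
  have lf : DifferentiableAt ℝ (fun y : E₁ × E₂ => f y.1 ^ 2) y := kf.comp y differentiableAt_fst
  have hpow : fderiv ℝ (fun t => f t ^ 2) y.1 u.1 = 2 * (f y.1 * fderiv ℝ f y.1 u.1) := by
    rw [fderiv_fun_pow 2 hf]
    simp
    ring
  simp only [localWarpedMetric]
  rw [fderiv_fun_add l₁ (lf.fun_mul l₂), fderiv_fun_mul lf l₂]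
  simp only [add_apply, smul_apply, smul_eq_mul]
  rw [fderiv_comp_fst_apply k₁, fderiv_comp_snd_apply k₂, fderiv_comp_fst_apply kf, hpow,
    fderiv_apply_const (h₁.clm_apply (differentiableAt_const _)), fderiv_apply_const h₁,
    fderiv_apply_const (h₂.clm_apply (differentiableAt_const _)), fderiv_apply_const h₂]
  ring

variable {F : Type*} [NormedAddCommGroup F] [NormedSpace ℝ F]
  {G : F → F →L[ℝ] F →L[ℝ] ℝ} {Γ : F → F →L[ℝ] F →L[ℝ] F} {Γ₁ : E₁ → E₁ →L[ℝ] E₁ →L[ℝ] E₁}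
  {Φ : E₁ × E₂ → F} {z : E₁ × E₂}

/-- The Koszul formula for the pull-back of a metric that is a warped product. -/
theorem IsLeviCivitaAt.koszul_warped (h : IsLeviCivitaAt G Γ (Φ z)) (hΦ : ContDiffAt ℝ ∞ Φ z)
    (hW : ∀ᶠ y in 𝓝 z, ∀ u v, pullbackMetric G Φ y u v = localWarpedMetric G₁ G₂ f y u v)
    (u v w : E₁ × E₂) :
    G (Φ z) (covHess Γ Φ z u v) (fderiv ℝ Φ z w) =
      (1 / 2) * (fderiv ℝ (fun y => localWarpedMetric G₁ G₂ f y v w) z u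
        + fderiv ℝ (fun y => localWarpedMetric G₁ G₂ f y u w) z v
        - fderiv ℝ (fun y => localWarpedMetric G₁ G₂ f y u v) z w) := by
  have e : ∀ a b, (fun y => pullbackMetric G Φ y a b) =ᶠ[𝓝 z]
      fun y => localWarpedMetric G₁ G₂ f y a b := fun a b => hW.mono fun y hy => hy a b
  rw [h.koszul hΦ, (e v w).fderiv_eq, (e u w).fderiv_eq, (e u v).fderiv_eq]

variable {u₁ : E₁} {v₂ : E₂}

/-- The tangential part of the Hessian of an isometric immersion of a warped product, on a pair
of vectors tangent to the leaf. -/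
theorem IsLeviCivitaAt.covHess_leaf (h : IsLeviCivitaAt G Γ (Φ z)) (h₁ : IsLeviCivitaAt G₁ Γ₁ z.1)
    (hΦ : ContDiffAt ℝ ∞ Φ z) (hG₂ : ContDiffAt ℝ ∞ G₂ z.2) (hf : ContDiffAt ℝ ∞ f z.1)
    (hW : ∀ᶠ y in 𝓝 z, ∀ u v, pullbackMetric G Φ y u v = localWarpedMetric G₁ G₂ f y u v)
    (w : E₁ × E₂) :
    G (Φ z) (covHess Γ Φ z (u₁, 0) (u₁, 0)) (fderiv ℝ Φ z w) =
      G (Φ z) (fderiv ℝ Φ z (Γ₁ z.1 u₁ u₁, 0)) (fderiv ℝ Φ z w) := by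
  have d₁ := (eventually_differentiableAt h₁.contDiffAt_metric).self_of_nhds
  have d₂ := (eventually_differentiableAt hG₂).self_of_nhds
  have df := (eventually_differentiableAt hf).self_of_nhds
  have hr := hW.self_of_nhds (Γ₁ z.1 u₁ u₁, 0) w
  rw [pullbackMetric] at hr
  rw [h.koszul_warped hΦ hW, hr, localWarpedMetric, h₁.koszul_const]
  simp only [fderiv_localWarpedMetric d₁ d₂ df]
  simp

/-- The tangential part of the Hessian of an isometric immersion of a warped product, on a vector
tangent to the leaf and a vector tangent to the fiber. -/
theorem IsLeviCivitaAt.covHess_mixed (h : IsLeviCivitaAt G Γ (Φ z))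
    (hΦ : ContDiffAt ℝ ∞ Φ z) (hG₁ : ContDiffAt ℝ ∞ G₁ z.1) (hG₂ : ContDiffAt ℝ ∞ G₂ z.2)
    (hf : ContDiffAt ℝ ∞ f z.1) (hf0 : f z.1 ≠ 0)
    (hW : ∀ᶠ y in 𝓝 z, ∀ u v, pullbackMetric G Φ y u v = localWarpedMetric G₁ G₂ f y u v)
    (w : E₁ × E₂) :
    G (Φ z) (covHess Γ Φ z (u₁, 0) (0, v₂)) (fderiv ℝ Φ z w) =
      G (Φ z) ((fderiv ℝ f z.1 u₁ / f z.1) • fderiv ℝ Φ z (0, v₂)) (fderiv ℝ Φ z w) := by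
  have d₁ := (eventually_differentiableAt hG₁).self_of_nhds
  have d₂ := (eventually_differentiableAt hG₂).self_of_nhds
  have df := (eventually_differentiableAt hf).self_of_nhds
  have hr := hW.self_of_nhds (0, v₂) w
  rw [pullbackMetric] at hr
  rw [h.koszul_warped hΦ hW, map_smul, smul_apply, hr, localWarpedMetric]
  simp only [fderiv_localWarpedMetric d₁ d₂ df]
  simp
  field_simp

/-- The Gauss equation for an isometric immersion of a warped product, on the plane spanned by
a vector tangent to the leaf and a vector tangent to the fiber. -/
theorem IsLeviCivitaAt.gauss_warped (h : IsLeviCivitaAt G Γ (Φ z))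
    (h₁ : IsLeviCivitaAt G₁ Γ₁ z.1)
    (hΦ : ContDiffAt ℝ ∞ Φ z) (hΓ : ∀ᶠ y in 𝓝 (Φ z), ∀ u v, christoffel G y u v = Γ y u v)
    (hG₂ : ContDiffAt ℝ ∞ G₂ z.2) (hf : ContDiffAt ℝ ∞ f z.1) (hf0 : f z.1 ≠ 0)
    (hW : ∀ᶠ y in 𝓝 z, ∀ u v, pullbackMetric G Φ y u v = localWarpedMetric G₁ G₂ f y u v) :
    G (Φ z) (localCurvature G (Φ z) (fderiv ℝ Φ z (u₁, 0)) (fderiv ℝ Φ z (0, v₂))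
        (fderiv ℝ Φ z (0, v₂))) (fderiv ℝ Φ z (u₁, 0))
      + G (Φ z) (covHess Γ Φ z (u₁, 0) (u₁, 0) - fderiv ℝ Φ z (Γ₁ z.1 u₁ u₁, 0))
          (covHess Γ Φ z (0, v₂) (0, v₂))
      - G (Φ z)
          (covHess Γ Φ z (u₁, 0) (0, v₂) - (fderiv ℝ f z.1 u₁ / f z.1) • fderiv ℝ Φ z (0, v₂))
          (covHess Γ Φ z (u₁, 0) (0, v₂) - (fderiv ℝ f z.1 u₁ / f z.1) • fderiv ℝ Φ z (0, v₂)) =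
    (fderiv ℝ f z.1 (Γ₁ z.1 u₁ u₁) - fderiv ℝ (fderiv ℝ f) z.1 u₁ u₁) / f z.1
      * G (Φ z) (fderiv ℝ Φ z (0, v₂)) (fderiv ℝ Φ z (0, v₂)) := by
  have e₁ := eventually_differentiableAt h₁.contDiffAt_metric
  have e₂ := eventually_differentiableAt hG₂
  have ef := eventually_differentiableAt hf
  have dff : DifferentiableAt ℝ (fderiv ℝ f) z.1 :=
    (eventually_differentiableAt (hf.fderiv_right (m := ∞) (by simp))).self_of_nhds
  have hs := (hΦ.continuousAt.eventually h.symm).self_of_nhds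
  have hd : ∀ᶠ y in 𝓝 z, ∀ a b u, fderiv ℝ (fun y => pullbackMetric G Φ y a b) y u =
      fderiv ℝ G₁ y.1 u.1 a.1 b.1 + 2 * (f y.1 * fderiv ℝ f y.1 u.1) * G₂ y.2 a.2 b.2
        + f y.1 ^ 2 * fderiv ℝ G₂ y.2 u.2 a.2 b.2 := by
    filter_upwards [hW.eventually_nhds, continuousAt_fst.eventually e₁,
      continuousAt_snd.eventually e₂, continuousAt_fst.eventually ef] with y hy k₁ k₂ kf a b u
    have e : (fun y => pullbackMetric G Φ y a b) =ᶠ[𝓝 y]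
        fun y => localWarpedMetric G₁ G₂ f y a b := hy.mono fun y hy => hy a b
    rw [e.fderiv_eq, fderiv_localWarpedMetric k₁ k₂ kf]
  -- Of the three second derivatives in the Gauss equation, two vanish: leaf and fiber are
  -- orthogonal everywhere, and the leaf metric does not vary along the fiber. Only the derivatives
  -- of `f²` along the leaf survive.
  have hD₁ : fderiv ℝ (fun y => fderiv ℝ (fun y => pullbackMetric G Φ y (u₁, 0) (0, v₂)) y
      (0, v₂)) z (u₁, 0) = 0 := by
    have e : (fun y => fderiv ℝ (fun y => pullbackMetric G Φ y (u₁, 0) (0, v₂)) y (0, v₂))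
        =ᶠ[𝓝 z] fun _ => 0 := by
      filter_upwards [hd] with y hy
      simp [hy]
    rw [e.fderiv_eq]
    simp
  have hD₂ : fderiv ℝ (fun y => fderiv ℝ (fun y => pullbackMetric G Φ y (u₁, 0) (u₁, 0)) y
      (0, v₂)) z (0, v₂) = 0 := by
    have e : (fun y => fderiv ℝ (fun y => pullbackMetric G Φ y (u₁, 0) (u₁, 0)) y (0, v₂))
        =ᶠ[𝓝 z] fun _ => 0 := by
      filter_upwards [hd] with y hy
      simp [hy]
    rw [e.fderiv_eq]
    simp
  have hD₃ : fderiv ℝ (fun y => fderiv ℝ (fun y => pullbackMetric G Φ y (0, v₂) (0, v₂)) y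
      (u₁, 0)) z (u₁, 0) = 2 * (fderiv ℝ f z.1 u₁ ^ 2 + f z.1 * fderiv ℝ (fderiv ℝ f) z.1 u₁ u₁)
        * G₂ z.2 v₂ v₂ := by
    have e : (fun y => fderiv ℝ (fun y => pullbackMetric G Φ y (0, v₂) (0, v₂)) y (u₁, 0))
        =ᶠ[𝓝 z] fun y => 2 * (f y.1 * fderiv ℝ f y.1 u₁) * G₂ y.2 v₂ v₂ := by
      filter_upwards [hd] with y hy
      simp [hy]
    have df := ef.self_of_nhds
    have dfu : DifferentiableAt ℝ (fun t => fderiv ℝ f t u₁) z.1 :=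
      dff.clm_apply (differentiableAt_const _)
    have k : DifferentiableAt ℝ (fun t => 2 * (f t * fderiv ℝ f t u₁)) z.1 :=
      (df.fun_mul dfu).const_mul 2
    have k₂ : DifferentiableAt ℝ (fun t => G₂ t v₂ v₂) z.2 :=
      (e₂.self_of_nhds.clm_apply (differentiableAt_const _)).clm_apply (differentiableAt_const _)
    have l : DifferentiableAt ℝ (fun y : E₁ × E₂ => 2 * (f y.1 * fderiv ℝ f y.1 u₁)) z :=
      k.comp z differentiableAt_fst
    have l₂ : DifferentiableAt ℝ (fun y : E₁ × E₂ => G₂ y.2 v₂ v₂) z :=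
      k₂.comp z differentiableAt_snd
    rw [e.fderiv_eq, fderiv_fun_mul l l₂]
    simp only [add_apply, smul_apply, smul_eq_mul]
    rw [fderiv_comp_fst_apply k, fderiv_comp_snd_apply k₂, fderiv_const_mul (df.fun_mul dfu),
      fderiv_fun_mul df dfu]
    simp only [add_apply, smul_apply, smul_eq_mul, map_zero]
    rw [fderiv_apply_const dff]
    ring
  have hvv : G (Φ z) (fderiv ℝ Φ z (0, v₂)) (fderiv ℝ Φ z (0, v₂)) = f z.1 ^ 2 * G₂ z.2 v₂ v₂ := by
    have := hW.self_of_nhds (0, v₂) (0, v₂)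
    simpa [pullbackMetric, localWarpedMetric] using this
  -- Dually to the leaf case, the fibers bend along the gradient of `f`. This pairing supplies the
  -- first-order part of the Hessian of `f`.
  have hT : G (Φ z) (covHess Γ Φ z (0, v₂) (0, v₂)) (fderiv ℝ Φ z (Γ₁ z.1 u₁ u₁, 0)) =
      -(f z.1 * fderiv ℝ f z.1 (Γ₁ z.1 u₁ u₁)) * G₂ z.2 v₂ v₂ := by
    rw [h.koszul_warped hΦ hW]
    simp only [fderiv_localWarpedMetric e₁.self_of_nhds e₂.self_of_nhds ef.self_of_nhds]
    simp
    ring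
  have hM := h.covHess_mixed (u₁ := u₁) (v₂ := v₂) hΦ h₁.contDiffAt_metric hG₂ hf hf0 hW (0, v₂)
  have hg := h.gauss hΦ hΓ (u₁, 0) (0, v₂)
  rw [hD₁, hD₂, hD₃] at hg
  simp only [map_sub, map_smul, sub_apply, smul_apply, smul_eq_mul] at hM ⊢
  rw [hs (fderiv ℝ Φ z (Γ₁ z.1 u₁ u₁, 0)), hT,
    hs (fderiv ℝ Φ z (0, v₂)) (covHess Γ Φ z (u₁, 0) (0, v₂)), hM, hvv]
  -- The squared length of the tangential part of the mixed Hessian; it cancels the `(u f)²` coming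
  -- from the second derivative of `f²`.
  have hc : fderiv ℝ f z.1 u₁ / f z.1 * (fderiv ℝ f z.1 u₁ / f z.1 * (f z.1 ^ 2 * G₂ z.2 v₂ v₂)) =
      fderiv ℝ f z.1 u₁ ^ 2 * G₂ z.2 v₂ v₂ := by
    field_simp
  have hq : (fderiv ℝ f z.1 (Γ₁ z.1 u₁ u₁) - fderiv ℝ (fderiv ℝ f) z.1 u₁ u₁) / f z.1
      * (f z.1 ^ 2 * G₂ z.2 v₂ v₂) = f z.1 * (fderiv ℝ f z.1 (Γ₁ z.1 u₁ u₁)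
        - fderiv ℝ (fderiv ℝ f) z.1 u₁ u₁) * G₂ z.2 v₂ v₂ := by
    field_simp
  rw [hq]
  linear_combination hg + hc

end LocalWarped

/-! ### Frame independence of the scalar curvature and of the Laplacian. -/

section Curvature

open Filter Topology

variable {E : Type*} [NormedAddCommGroup E] [NormedSpace ℝ E]
  {N : Type*} [TopologicalSpace N] [ChartedSpace E N] [IsManifold 𝓘(ℝ, E) ∞ N]

/-- The metric at a point as a bilinear form. -/
def metricForm (g : Metric E N) (p : N) :
    TangentSpace 𝓘(ℝ, E) p →ₗ[ℝ] TangentSpace 𝓘(ℝ, E) p →ₗ[ℝ] ℝ :=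
  LinearMap.mk₂ ℝ (fun u v => g.inner p u v) (by simp) (by simp) (by simp) (by simp)

theorem metricForm_symm (g : Metric E N) (p : N) (u v : TangentSpace 𝓘(ℝ, E) p) :
    metricForm g p u v = metricForm g p v u := g.symm p u v

theorem metricForm_pos (g : Metric E N) (p : N) (v : TangentSpace 𝓘(ℝ, E) p) (hv : v ≠ 0) :
    0 < metricForm g p v v := g.pos p v hv

/-- Derivatives of components become components of the derivative of the bundled connection, which
makes multilinearity visible. -/
theorem localCurvature_eq {G : E → E →L[ℝ] E →L[ℝ] ℝ} {z : E}
    (h : DifferentiableAt ℝ (christoffelCLM G) z) (u v w : E) :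
    localCurvature G z u v w =
      fderiv ℝ (christoffelCLM G) z u v w - fderiv ℝ (christoffelCLM G) z v u w
        + christoffelCLM G z u (christoffelCLM G z v w)
        - christoffelCLM G z v (christoffelCLM G z u w) := by
  have k : ∀ a b c, fderiv ℝ (fun y => christoffel G y b c) z a =
      fderiv ℝ (christoffelCLM G) z a b c := fun a b c => by
    simp_rw [← christoffelCLM_apply]
    rw [fderiv_apply_const (h.clm_apply (differentiableAt_const b)), fderiv_apply_const h]
  rw [localCurvature, k, k]
  rfl

/-- The form `(u, u') ↦ B (R(u, v) v, u')`. -/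
def localCurvatureForm (G : E → E →L[ℝ] E →L[ℝ] ℝ) (z : E) (B : E →ₗ[ℝ] E →ₗ[ℝ] ℝ)
    (h : DifferentiableAt ℝ (christoffelCLM G) z) (v : E) : E →ₗ[ℝ] E →ₗ[ℝ] ℝ :=
  LinearMap.mk₂ ℝ (fun u u' => B (localCurvature G z u v v) u')
    (fun a b c => by
      simp only [localCurvature_eq h, map_add, map_sub, add_apply, LinearMap.add_apply,
        LinearMap.sub_apply]
      ring)
    (fun a b c => by
      simp only [localCurvature_eq h, map_smul, map_add, map_sub, smul_apply, LinearMap.smul_apply,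
        LinearMap.add_apply, LinearMap.sub_apply, smul_eq_mul]
      ring)
    (fun _ _ _ => map_add _ _ _) (fun _ _ _ => map_smul _ _ _)

variable [FiniteDimensional ℝ E] (g : Metric E N) (p : N)

theorem differentiableAt_christoffelCLM :
    DifferentiableAt ℝ (christoffelCLM (chartMetric g p)) (extChartAt 𝓘(ℝ, E) p p) :=
  (eventually_differentiableAt
    (isLeviCivitaAt_chartMetric g (mem_extChartAt_target p)).contDiffAt).self_of_nhds

/-- The form `(u, u') ↦ g (R(u, v) v, u')`. -/
def curvatureForm (v : TangentSpace 𝓘(ℝ, E) p) :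
    TangentSpace 𝓘(ℝ, E) p →ₗ[ℝ] TangentSpace 𝓘(ℝ, E) p →ₗ[ℝ] ℝ :=
  localCurvatureForm (E := E) (chartMetric g p) (extChartAt 𝓘(ℝ, E) p p) (metricForm g p)
    (differentiableAt_christoffelCLM g p) v

theorem curvatureForm_apply (u v u' : TangentSpace 𝓘(ℝ, E) p) :
    curvatureForm g p v u u' = g.inner p (riemannCurvature g p u v v) u' := rfl

/-- The coordinate symmetry, read at the base point, where the chart metric is `g`. -/
theorem curvatureForm_symm (u v : TangentSpace 𝓘(ℝ, E) p) :
    curvatureForm g p v u u = curvatureForm g p u v v := by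
  have h := (isLeviCivitaAt_chartMetric g (mem_extChartAt_target p)).localCurvature_symm
    (.of_forall fun y u v => (christoffelCLM_apply _ y u v).symm) u v
  exact (chartMetric_self g p _ u).symm.trans (h.trans (chartMetric_self g p _ v))

theorem curvatureForm_self (u : TangentSpace 𝓘(ℝ, E) p) : curvatureForm g p u u u = 0 := by
  have h0 : ∀ (G : E → E →L[ℝ] E →L[ℝ] ℝ) (z w : E), localCurvature G z w w w = 0 := fun G z w => by
    simp [localCurvature]
  have h : riemannCurvature g p u u u = 0 := h0 _ _ _
  rw [curvatureForm_apply, h]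
  simp

/-- Twice the scalar curvature of a subspace is the double trace of the curvature. -/
theorem two_mul_scalarCurvature {L : Submodule ℝ (TangentSpace 𝓘(ℝ, E) p)}
    {ι : Type*} [Fintype ι] [DecidableEq ι] {e : ι → TangentSpace 𝓘(ℝ, E) p}
    (he : IsOrthonormalFrame (fun u v => g.inner p u v) L e) :
    2 * scalarCurvature g p L = ∑ i, ∑ j, curvatureForm g p (e j) (e i) (e i) := by
  have : FiniteDimensional ℝ (TangentSpace 𝓘(ℝ, E) p) := inferInstanceAs (FiniteDimensional ℝ E)
  have h0 : IsOrthonormalFrame (fun u v => g.inner p u v) L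
      (orthonormalFrame (fun u v => g.inner p u v) L) :=
    isOrthonormalFrame_orthonormalFrame (metricForm g p) (metricForm_symm g p)
      (metricForm_pos g p) L
  have hs : ∀ i, ∀ j ∈ Finset.Ioi i,
      sectionalCurvature g p (orthonormalFrame (fun u v => g.inner p u v) L i)
        (orthonormalFrame (fun u v => g.inner p u v) L j) =
      curvatureForm g p (orthonormalFrame (fun u v => g.inner p u v) L j)
        (orthonormalFrame (fun u v => g.inner p u v) L i)
        (orthonormalFrame (fun u v => g.inner p u v) L i) := by
    intro i j hij
    have h1 := h0.1 i i
    have h2 := h0.1 j j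
    have h3 := h0.1 i j
    rw [if_pos rfl] at h1 h2
    rw [if_neg (Finset.mem_Ioi.1 hij).ne] at h3
    change g.inner p _ _ = (1 : ℝ) at h1 h2
    change g.inner p _ _ = (0 : ℝ) at h3
    -- For an orthonormal pair the denominator of the sectional curvature is one.
    have hd : ∀ r : ℝ, r / (1 * 1 - 0 ^ 2) = r := fun r => by norm_num
    rw [sectionalCurvature, h1, h2, h3, hd]
    rfl
  rw [scalarCurvature, Finset.sum_congr rfl fun i _ => Finset.sum_congr rfl (hs i),
    two_mul_sum_Ioi _ (fun i j => curvatureForm_symm g p _ _) fun i => curvatureForm_self g p _]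
  -- Trace invariance changes the frame in one slot of the double sum; the symmetry exchanges the
  -- slots, and a second application changes the other.
  have t := IsOrthonormalFrame.sum_eq_sum (metricForm_symm g p) h0 he
  calc _ = ∑ j, ∑ i, curvatureForm g p (orthonormalFrame (fun u v => g.inner p u v) L j)
        (e i) (e i) := by
        rw [Finset.sum_comm]
        exact Finset.sum_congr rfl fun j _ => t _
    _ = ∑ i, ∑ j, curvatureForm g p (e i) (orthonormalFrame (fun u v => g.inner p u v) L j)
        (orthonormalFrame (fun u v => g.inner p u v) L j) := by
        rw [Finset.sum_comm]
        exact Finset.sum_congr rfl fun i _ => Finset.sum_congr rfl fun j _ =>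
          curvatureForm_symm g p _ _
    _ = ∑ i, ∑ j, curvatureForm g p (e i) (e j) (e j) :=
        Finset.sum_congr rfl fun i _ => t _
    _ = _ := Finset.sum_comm

/-- The Laplacian computed in any orthonormal frame. -/
theorem laplacian_eq_sum {f : N → ℝ} {ι : Type*} [Fintype ι] [DecidableEq ι]
    {e : ι → TangentSpace 𝓘(ℝ, E) p}
    (he : IsOrthonormalFrame (fun u v => g.inner p u v) ⊤ e) :
    laplacian g f p = ∑ i,
      (fderiv ℝ (fun y => f ((extChartAt 𝓘(ℝ, E) p).symm y)) (extChartAt 𝓘(ℝ, E) p p)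
          (christoffel (chartMetric g p) (extChartAt 𝓘(ℝ, E) p p) (e i) (e i))
        - fderiv ℝ (fderiv ℝ (fun y => f ((extChartAt 𝓘(ℝ, E) p).symm y)))
            (extChartAt 𝓘(ℝ, E) p p) (e i) (e i)) := by
  have : FiniteDimensional ℝ (TangentSpace 𝓘(ℝ, E) p) := inferInstanceAs (FiniteDimensional ℝ E)
  have h0 := isOrthonormalFrame_orthonormalFrame (metricForm g p) (metricForm_symm g p)
    (metricForm_pos g p) ⊤
  let f' : E → ℝ := fun y => f ((extChartAt 𝓘(ℝ, E) p).symm y)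
  let z : E := extChartAt 𝓘(ℝ, E) p p
  -- Minus the Hessian of `f`, whose trace is the Laplacian.
  let Q : E →ₗ[ℝ] E →ₗ[ℝ] ℝ := LinearMap.mk₂ ℝ
    (fun u v => fderiv ℝ f' z (christoffelCLM (chartMetric g p) z u v)
      - fderiv ℝ (fderiv ℝ f') z u v)
    (by intros; simp only [map_add, add_apply]; ring)
    (by intros; simp only [map_smul, smul_apply, smul_eq_mul]; ring)
    (by intros; simp only [map_add]; ring)
    (by intros; simp only [map_smul, smul_eq_mul]; ring)
  exact IsOrthonormalFrame.sum_eq_sum (metricForm_symm g p) h0 he Q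

end Curvature

/-! ### The ambient derivative in charts. -/

section Immersion

open Filter Topology

variable {E H : Type*} [NormedAddCommGroup E] [NormedSpace ℝ E] [TopologicalSpace H]
  {I : ModelWithCorners ℝ E H} [I.Boundaryless] {M : Type*} [TopologicalSpace M]
  [ChartedSpace H M]
  {F : Type*} [NormedAddCommGroup F] [NormedSpace ℝ F]
  {P : Type*} [TopologicalSpace P] [ChartedSpace F P] [IsManifold 𝓘(ℝ, F) ∞ P]

/-- The ambient derivative is the covariant Hessian of the immersion in charts. -/
theorem ambientDerivative_eq_covHess (g : Metric F P) {φ : M → P}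
    (hφ : ContMDiff I 𝓘(ℝ, F) ∞ φ) (x : M) (u v : TangentSpace I x) :
    ambientDerivative I g φ x u v = covHess (christoffelCLM (chartMetric g (φ x)))
      (writtenInExtChartAt I 𝓘(ℝ, F) x φ) (extChartAt I x x) u v := by
  have h := (eventually_differentiableAt
    ((contDiffAt_writtenInExtChartAt hφ x).fderiv_right (m := ∞) (by simp))).self_of_nhds
  have h2 : covHess (christoffelCLM (chartMetric g (φ x)))
      (writtenInExtChartAt I 𝓘(ℝ, F) x φ) (extChartAt I x x) u v = _ :=
    congrArg (· + _) (fderiv_apply_const h (v : E) (u : E))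
  rw [h2, writtenInExtChartAt_self]
  rfl

end Immersion

/-! ### Geometry of the product manifold and its warped metric. -/

section Product

open Filter Topology

variable {E₁ E₂ : Type*} [NormedAddCommGroup E₁] [NormedSpace ℝ E₁]
  [NormedAddCommGroup E₂] [NormedSpace ℝ E₂]
  {N₁ N₂ : Type*} [TopologicalSpace N₁] [ChartedSpace E₁ N₁]
  [TopologicalSpace N₂] [ChartedSpace E₂ N₂]

theorem dπ₁_apply (x : N₁ × N₂) (u : E₁ × E₂) :
    dπ₁ x (u : ProdTangent E₁ E₂ x) = u.1 := by
  rw [dπ₁, mfderiv_fst]; rfl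

theorem dπ₂_apply (x : N₁ × N₂) (u : E₁ × E₂) :
    dπ₂ x (u : ProdTangent E₁ E₂ x) = u.2 := by
  rw [dπ₂, mfderiv_snd]; rfl

theorem mem_distribution₁ {x : N₁ × N₂} {u : E₁ × E₂} :
    (u : ProdTangent E₁ E₂ x) ∈ distribution₁ E₁ E₂ x ↔ u.2 = 0 := by
  rw [← dπ₂_apply x u]; rfl

theorem mem_distribution₂ {x : N₁ × N₂} {u : E₁ × E₂} :
    (u : ProdTangent E₁ E₂ x) ∈ distribution₂ E₁ E₂ x ↔ u.1 = 0 := by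
  rw [← dπ₁_apply x u]; rfl

theorem distribution₁_sup_distribution₂ (x : N₁ × N₂) :
    distribution₁ E₁ E₂ x ⊔ distribution₂ E₁ E₂ x = ⊤ := by
  refine eq_top_iff.2 fun (u : E₁ × E₂) _ => ?_
  have h : u = (u.1, 0) + (0, u.2) := by simp
  rw [h]
  exact Submodule.add_mem_sup (mem_distribution₁.2 rfl) (mem_distribution₂.2 rfl)

theorem finrank_distribution₂ (x : N₁ × N₂) :
    Module.finrank ℝ (distribution₂ E₁ E₂ x) = Module.finrank ℝ E₂ := by
  have h : Function.Injective (LinearMap.inr ℝ E₁ E₂) := LinearMap.inr_injective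
  rw [← LinearMap.finrank_range_of_inj h]
  have e : (distribution₂ E₁ E₂ x : Submodule ℝ (E₁ × E₂)) =
      LinearMap.range (LinearMap.inr ℝ E₁ E₂) :=
    Submodule.ext fun u => (mem_distribution₂ (x := x) (u := u)).trans
      (by rw [LinearMap.range_inr]; exact Iff.rfl)
  exact congrArg (fun L : Submodule ℝ (E₁ × E₂) => Module.finrank ℝ L) e

variable [IsManifold 𝓘(ℝ, E₁) ∞ N₁] [IsManifold 𝓘(ℝ, E₂) ∞ N₂]

/-- The warped product metric as a bilinear form. -/
def warpedForm (g₁ : Metric E₁ N₁) (g₂ : Metric E₂ N₂) (f : N₁ → ℝ) (x : N₁ × N₂) :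
    ProdTangent E₁ E₂ x →ₗ[ℝ] ProdTangent E₁ E₂ x →ₗ[ℝ] ℝ :=
  LinearMap.mk₂ ℝ (warpedMetric g₁ g₂ f x)
    (fun a b c => by simp only [warpedMetric, map_add, add_apply]; ring)
    (fun r a b => by simp only [warpedMetric, map_smul, smul_apply, smul_eq_mul]; ring)
    (fun a b c => by simp only [warpedMetric, map_add]; ring)
    (fun r a b => by simp only [warpedMetric, map_smul, smul_eq_mul]; ring)

/-- The inverse product chart yields a point that must be rewritten as a pair; the tangent vectors
are read in the model spaces so that this equality can be substituted. -/
theorem warpedMetric_eq_of_eq (g₁ : Metric E₁ N₁) (g₂ : Metric E₂ N₂) (f : N₁ → ℝ) {q : N₁ × N₂}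
    {q₁ : N₁} {q₂ : N₂} (hq : q = (q₁, q₂)) {u v : ProdTangent E₁ E₂ q} {a b : E₁} {c d : E₂}
    (ha : (dπ₁ q u : E₁) = a) (hb : (dπ₁ q v : E₁) = b) (hc : (dπ₂ q u : E₂) = c)
    (hd : (dπ₂ q v : E₂) = d) :
    warpedMetric g₁ g₂ f q u v =
      (g₁.inner q₁ : E₁ →L[ℝ] E₁ →L[ℝ] ℝ) a b
        + f q₁ ^ 2 * (g₂.inner q₂ : E₂ →L[ℝ] E₂ →L[ℝ] ℝ) c d := by
  subst hq ha hb hc hd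
  rfl

theorem warpedMetric_symm (g₁ : Metric E₁ N₁) (g₂ : Metric E₂ N₂) (f : N₁ → ℝ) (x : N₁ × N₂)
    (u v : ProdTangent E₁ E₂ x) : warpedMetric g₁ g₂ f x u v = warpedMetric g₁ g₂ f x v u := by
  rw [warpedMetric, warpedMetric, g₁.symm, g₂.symm]

theorem warpedMetric_pos (g₁ : Metric E₁ N₁) (g₂ : Metric E₂ N₂) {f : N₁ → ℝ} {x : N₁ × N₂}
    (hf : 0 < f x.1) (u : ProdTangent E₁ E₂ x) (hu : u ≠ 0) : 0 < warpedMetric g₁ g₂ f x u u := by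
  have hn₁ : 0 ≤ g₁.inner x.1 (dπ₁ x u) (dπ₁ x u) := by
    by_cases h : dπ₁ x u = 0
    · simp [h]
    · exact (g₁.pos _ _ h).le
  have hn₂ : 0 ≤ g₂.inner x.2 (dπ₂ x u) (dπ₂ x u) := by
    by_cases h : dπ₂ x u = 0
    · simp [h]
    · exact (g₂.pos _ _ h).le
  rw [warpedMetric]
  by_cases h : dπ₁ x u = 0
  · have h2 : dπ₂ x u ≠ 0 := fun h2 => hu (Prod.ext ((dπ₁_apply x u).symm.trans h)
      ((dπ₂_apply x u).symm.trans h2))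
    have := g₂.pos _ _ h2
    positivity
  · have := g₁.pos _ _ h
    positivity

/-- The inverse of a product chart commutes with the projections; the chain rule on both sides gives
the claim. -/
theorem dπ₁_mfderiv_extChartAt_symm (x : N₁ × N₂) {y : E₁ × E₂}
    (hy : y ∈ (extChartAt (𝓘(ℝ, E₁).prod 𝓘(ℝ, E₂)) x).target) (u : E₁ × E₂) :
    dπ₁ _ (mfderiv 𝓘(ℝ, E₁ × E₂) (𝓘(ℝ, E₁).prod 𝓘(ℝ, E₂))
      (extChartAt (𝓘(ℝ, E₁).prod 𝓘(ℝ, E₂)) x).symm y u) =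
      mfderiv 𝓘(ℝ, E₁) 𝓘(ℝ, E₁) (extChartAt 𝓘(ℝ, E₁) x.1).symm y.1 u.1 := by
  have hy₁ : y.1 ∈ (extChartAt 𝓘(ℝ, E₁) x.1).target := by
    rw [extChartAt_prod] at hy; exact hy.1
  have c₁ : mfderiv 𝓘(ℝ, E₁ × E₂) 𝓘(ℝ, E₁)
      (Prod.fst ∘ (extChartAt (𝓘(ℝ, E₁).prod 𝓘(ℝ, E₂)) x).symm) y = _ :=
    mfderiv_comp y mdifferentiableAt_fst
      ((contMDiffAt_extChartAt_symm_of_mem hy).mdifferentiableAt (by simp))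
  have c₂ : mfderiv 𝓘(ℝ, E₁ × E₂) 𝓘(ℝ, E₁) ((extChartAt 𝓘(ℝ, E₁) x.1).symm ∘ Prod.fst) y = _ :=
    mfderiv_comp y ((contMDiffAt_extChartAt_symm_of_mem hy₁).mdifferentiableAt (by simp))
      differentiableAt_fst.mdifferentiableAt
  have e : (Prod.fst ∘ (extChartAt (𝓘(ℝ, E₁).prod 𝓘(ℝ, E₂)) x).symm) =
      ((extChartAt 𝓘(ℝ, E₁) x.1).symm ∘ Prod.fst) := by
    rw [extChartAt_prod]; rfl
  rw [mfderiv_eq_fderiv, fderiv_fst] at c₂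
  have c₃ := congrArg (fun k : E₁ × E₂ → N₁ =>
    (mfderiv 𝓘(ℝ, E₁ × E₂) 𝓘(ℝ, E₁) k y : E₁ × E₂ →L[ℝ] E₁) u) e
  have c₄ := congrArg (fun A : E₁ × E₂ →L[ℝ] E₁ => A u) c₁
  have c₅ := congrArg (fun A : E₁ × E₂ →L[ℝ] E₁ => A u) c₂
  exact c₄.symm.trans (c₃.trans c₅)

theorem dπ₂_mfderiv_extChartAt_symm (x : N₁ × N₂) {y : E₁ × E₂}
    (hy : y ∈ (extChartAt (𝓘(ℝ, E₁).prod 𝓘(ℝ, E₂)) x).target) (u : E₁ × E₂) :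
    dπ₂ _ (mfderiv 𝓘(ℝ, E₁ × E₂) (𝓘(ℝ, E₁).prod 𝓘(ℝ, E₂))
      (extChartAt (𝓘(ℝ, E₁).prod 𝓘(ℝ, E₂)) x).symm y u) =
      mfderiv 𝓘(ℝ, E₂) 𝓘(ℝ, E₂) (extChartAt 𝓘(ℝ, E₂) x.2).symm y.2 u.2 := by
  have hy₂ : y.2 ∈ (extChartAt 𝓘(ℝ, E₂) x.2).target := by
    rw [extChartAt_prod] at hy; exact hy.2
  have c₁ : mfderiv 𝓘(ℝ, E₁ × E₂) 𝓘(ℝ, E₂)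
      (Prod.snd ∘ (extChartAt (𝓘(ℝ, E₁).prod 𝓘(ℝ, E₂)) x).symm) y = _ :=
    mfderiv_comp y mdifferentiableAt_snd
      ((contMDiffAt_extChartAt_symm_of_mem hy).mdifferentiableAt (by simp))
  have c₂ : mfderiv 𝓘(ℝ, E₁ × E₂) 𝓘(ℝ, E₂) ((extChartAt 𝓘(ℝ, E₂) x.2).symm ∘ Prod.snd) y = _ :=
    mfderiv_comp y ((contMDiffAt_extChartAt_symm_of_mem hy₂).mdifferentiableAt (by simp))
      differentiableAt_snd.mdifferentiableAt
  have e : (Prod.snd ∘ (extChartAt (𝓘(ℝ, E₁).prod 𝓘(ℝ, E₂)) x).symm) =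
      ((extChartAt 𝓘(ℝ, E₂) x.2).symm ∘ Prod.snd) := by
    rw [extChartAt_prod]; rfl
  rw [mfderiv_eq_fderiv, fderiv_snd] at c₂
  have c₃ := congrArg (fun k : E₁ × E₂ → N₂ =>
    (mfderiv 𝓘(ℝ, E₁ × E₂) 𝓘(ℝ, E₂) k y : E₁ × E₂ →L[ℝ] E₂) u) e
  have c₄ := congrArg (fun A : E₁ × E₂ →L[ℝ] E₂ => A u) c₁
  have c₅ := congrArg (fun A : E₁ × E₂ →L[ℝ] E₂ => A u) c₂
  exact c₄.symm.trans (c₃.trans c₅)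

variable {F : Type*} [NormedAddCommGroup F] [NormedSpace ℝ F]
  {P : Type*} [TopologicalSpace P] [ChartedSpace F P] [IsManifold 𝓘(ℝ, F) ∞ P]

/-- In product charts, the metric induced by an isometric immersion is a warped product. -/
theorem IsIsometricImmersion.pullbackMetric_eq {g₁ : Metric E₁ N₁} {g₂ : Metric E₂ N₂}
    {f : N₁ → ℝ} {g : Metric F P} {φ : N₁ × N₂ → P} (hφ : IsIsometricImmersion g₁ g₂ f g φ)
    (x : N₁ × N₂) :
    ∀ᶠ y in 𝓝 (extChartAt (𝓘(ℝ, E₁).prod 𝓘(ℝ, E₂)) x x), ∀ u v : E₁ × E₂,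
      pullbackMetric (chartMetric g (φ x))
        (writtenInExtChartAt (𝓘(ℝ, E₁).prod 𝓘(ℝ, E₂)) 𝓘(ℝ, F) x φ) y u v =
      localWarpedMetric (chartMetric g₁ x.1) (chartMetric g₂ x.2)
        (fun t => f ((extChartAt 𝓘(ℝ, E₁) x.1).symm t)) y u v := by
  filter_upwards [pullbackMetric_writtenInExtChartAt g hφ.1 x,
    (isOpen_extChartAt_target x).eventually_mem (mem_extChartAt_target x)] with y hy hyt u v
  have e : (extChartAt (𝓘(ℝ, E₁).prod 𝓘(ℝ, E₂)) x).symm y =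
      ((extChartAt 𝓘(ℝ, E₁) x.1).symm y.1, (extChartAt 𝓘(ℝ, E₂) x.2).symm y.2) := by
    rw [extChartAt_prod]; rfl
  rw [hy, hφ.2, localWarpedMetric, chartMetric_apply, chartMetric_apply]
  exact warpedMetric_eq_of_eq g₁ g₂ f e (dπ₁_mfderiv_extChartAt_symm x hyt u)
    (dπ₁_mfderiv_extChartAt_symm x hyt v) (dπ₂_mfderiv_extChartAt_symm x hyt u)
    (dπ₂_mfderiv_extChartAt_symm x hyt v)

end Product

/-! ### Second fundamental form and tangential parts. -/

section SecondFundamentalForm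

variable {E H : Type*} [NormedAddCommGroup E] [NormedSpace ℝ E] [TopologicalSpace H]
  {I : ModelWithCorners ℝ E H} {M : Type*} [TopologicalSpace M]
  [ChartedSpace H M]
  {F : Type*} [NormedAddCommGroup F] [NormedSpace ℝ F] [FiniteDimensional ℝ F]
  {P : Type*} [TopologicalSpace P] [ChartedSpace F P] [IsManifold 𝓘(ℝ, F) ∞ P]

/-- The tangential part is determined by its products with tangent vectors, so a `t` obtained from
the Koszul formula computes the projection. -/
theorem secondFundamentalForm_eq_sub (g : Metric F P) (φ : M → P) (x : M) {u v : TangentSpace I x}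
    (t : TangentSpace I x)
    (ht : ∀ w, g.inner (φ x) (ambientDerivative I g φ x u v) (mfderiv I 𝓘(ℝ, F) φ x w) =
      g.inner (φ x) (mfderiv I 𝓘(ℝ, F) φ x t) (mfderiv I 𝓘(ℝ, F) φ x w)) :
    secondFundamentalForm I g φ x u v =
      ambientDerivative I g φ x u v - mfderiv I 𝓘(ℝ, F) φ x t := by
  have : FiniteDimensional ℝ (TangentSpace 𝓘(ℝ, F) (φ x)) :=
    inferInstanceAs (FiniteDimensional ℝ F)
  refine normalPart_eq_sub (metricForm_symm g (φ x)) (metricForm_pos g (φ x))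
    (tangentImage I φ x ⊤) ⟨t, trivial, rfl⟩ ?_
  rintro _ ⟨w, -, rfl⟩
  exact ht w

theorem inner_secondFundamentalForm_mfderiv (g : Metric F P) (φ : M → P) (x : M)
    (u v w : TangentSpace I x) :
    g.inner (φ x) (secondFundamentalForm I g φ x u v) (mfderiv I 𝓘(ℝ, F) φ x w) = 0 := by
  have : FiniteDimensional ℝ (TangentSpace 𝓘(ℝ, F) (φ x)) :=
    inferInstanceAs (FiniteDimensional ℝ F)
  exact normalPart_orthogonal (metricForm_symm g (φ x)) (metricForm_pos g (φ x))
    (tangentImage I φ x ⊤) _ ⟨w, trivial, rfl⟩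

/-- A normal vector ignores the tangential part of the other factor. Hence the tangential part of
the Hessian on fiber vectors, which involves the gradient of `f`, need not be identified. -/
theorem inner_secondFundamentalForm_secondFundamentalForm (g : Metric F P) (φ : M → P) (x : M)
    (u v u' v' : TangentSpace I x) :
    g.inner (φ x) (secondFundamentalForm I g φ x u v) (secondFundamentalForm I g φ x u' v') =
      g.inner (φ x) (secondFundamentalForm I g φ x u v) (ambientDerivative I g φ x u' v') := by
  have : FiniteDimensional ℝ (TangentSpace 𝓘(ℝ, F) (φ x)) :=
    inferInstanceAs (FiniteDimensional ℝ F)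
  have h0 := isOrthonormalFrame_orthonormalFrame (metricForm g (φ x)) (metricForm_symm g (φ x))
    (metricForm_pos g (φ x)) (tangentImage I φ x ⊤)
  have hm : ∑ i, metricForm g (φ x) (ambientDerivative I g φ x u' v')
      (orthonormalFrame (fun u v => metricForm g (φ x) u v) (tangentImage I φ x ⊤) i) •
      orthonormalFrame (fun u v => metricForm g (φ x) u v) (tangentImage I φ x ⊤) i ∈
      tangentImage I φ x ⊤ :=
    Submodule.sum_mem _ fun i _ => Submodule.smul_mem _ _ (h0.mem i)
  obtain ⟨t, -, ht⟩ := hm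
  have e : secondFundamentalForm I g φ x u' v' =
      ambientDerivative I g φ x u' v' - mfderiv I 𝓘(ℝ, F) φ x t :=
    congrArg (ambientDerivative I g φ x u' v' - ·) ht.symm
  rw [e, map_sub, inner_secondFundamentalForm_mfderiv, sub_zero]

end SecondFundamentalForm

/-! ### Minimality and the mixed Gauss equation on the manifold. -/

section WarpedGauss

open Filter Topology

variable {E₁ E₂ : Type*} [NormedAddCommGroup E₁] [NormedSpace ℝ E₁]
  [NormedAddCommGroup E₂] [NormedSpace ℝ E₂]
  {N₁ N₂ : Type*} [TopologicalSpace N₁] [ChartedSpace E₁ N₁] [IsManifold 𝓘(ℝ, E₁) ∞ N₁]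
  [TopologicalSpace N₂] [ChartedSpace E₂ N₂] [IsManifold 𝓘(ℝ, E₂) ∞ N₂]
  {F : Type*} [NormedAddCommGroup F] [NormedSpace ℝ F]
  {P : Type*} [TopologicalSpace P] [ChartedSpace F P] [IsManifold 𝓘(ℝ, F) ∞ P]
  {g₁ : Metric E₁ N₁} {g₂ : Metric E₂ N₂} {f : N₁ → ℝ} {g : Metric F P} {φ : N₁ × N₂ → P}

/-- The double sum is the inner product of the traces of `h` on the two distributions, so either
alternative of minimality suffices. -/
theorem IsDMinimal.sum_inner_eq_zero (hmin : IsDMinimal g₁ g₂ f g φ) (x : N₁ × N₂) :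
    ∑ a, ∑ b, g.inner (φ x)
      (secondFundamentalForm (𝓘(ℝ, E₁).prod 𝓘(ℝ, E₂)) g φ x
        (orthonormalFrame (warpedMetric g₁ g₂ f x) (distribution₁ E₁ E₂ x) a)
        (orthonormalFrame (warpedMetric g₁ g₂ f x) (distribution₁ E₁ E₂ x) a))
      (secondFundamentalForm (𝓘(ℝ, E₁).prod 𝓘(ℝ, E₂)) g φ x
        (orthonormalFrame (warpedMetric g₁ g₂ f x) (distribution₂ E₁ E₂ x) b)
        (orthonormalFrame (warpedMetric g₁ g₂ f x) (distribution₂ E₁ E₂ x) b)) = 0 := by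
  have hz : ∀ D : Submodule ℝ (ProdTangent E₁ E₂ x), partialMeanCurvature g₁ g₂ f g φ x D = 0 →
      ∑ a, secondFundamentalForm (𝓘(ℝ, E₁).prod 𝓘(ℝ, E₂)) g φ x
        (orthonormalFrame (warpedMetric g₁ g₂ f x) D a)
        (orthonormalFrame (warpedMetric g₁ g₂ f x) D a) = 0 := by
    intro D hD
    -- The factor `1 / dim D` is zero exactly when `D` has dimension zero, and then the sum is
    -- empty.
    rcases smul_eq_zero.1 hD with h | h
    · have h0 : Module.finrank ℝ D = 0 := by simpa using h
      have : IsEmpty (Fin (Module.finrank ℝ D)) := by rw [h0]; infer_instance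
      exact Finset.sum_of_isEmpty _
    · exact h
  simp_rw [← map_sum]
  rcases hmin with h | h
  · rw [← sum_apply, ← map_sum, hz _ (h x)]
    simp
  · rw [hz _ (h x)]
    simp

variable [FiniteDimensional ℝ E₁] [FiniteDimensional ℝ E₂] [FiniteDimensional ℝ F]

/-- The Gauss equation on a plane spanned by vectors tangent to the leaf and to the fiber. -/
theorem IsIsometricImmersion.gauss_mixed (hφ : IsIsometricImmersion g₁ g₂ f g φ)
    (hf : ContMDiff 𝓘(ℝ, E₁) 𝓘(ℝ) ∞ f) (x : N₁ × N₂) (hf0 : f x.1 ≠ 0) {u v : ProdTangent E₁ E₂ x}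
    (hu : u ∈ distribution₁ E₁ E₂ x) (hv : v ∈ distribution₂ E₁ E₂ x) :
    curvatureForm g (φ x) (mfderiv (𝓘(ℝ, E₁).prod 𝓘(ℝ, E₂)) 𝓘(ℝ, F) φ x v)
        (mfderiv (𝓘(ℝ, E₁).prod 𝓘(ℝ, E₂)) 𝓘(ℝ, F) φ x u)
        (mfderiv (𝓘(ℝ, E₁).prod 𝓘(ℝ, E₂)) 𝓘(ℝ, F) φ x u)
      + g.inner (φ x) (secondFundamentalForm (𝓘(ℝ, E₁).prod 𝓘(ℝ, E₂)) g φ x u u)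
          (secondFundamentalForm (𝓘(ℝ, E₁).prod 𝓘(ℝ, E₂)) g φ x v v)
      - g.inner (φ x) (secondFundamentalForm (𝓘(ℝ, E₁).prod 𝓘(ℝ, E₂)) g φ x u v)
          (secondFundamentalForm (𝓘(ℝ, E₁).prod 𝓘(ℝ, E₂)) g φ x u v) =
    (fderiv ℝ (fun y => f ((extChartAt 𝓘(ℝ, E₁) x.1).symm y)) (extChartAt 𝓘(ℝ, E₁) x.1 x.1)
          (christoffel (chartMetric g₁ x.1) (extChartAt 𝓘(ℝ, E₁) x.1 x.1) (dπ₁ x u) (dπ₁ x u))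
        - fderiv ℝ (fderiv ℝ (fun y => f ((extChartAt 𝓘(ℝ, E₁) x.1).symm y)))
            (extChartAt 𝓘(ℝ, E₁) x.1 x.1) (dπ₁ x u) (dπ₁ x u)) / f x.1
      * warpedMetric g₁ g₂ f x v v := by
  rw [inner_secondFundamentalForm_secondFundamentalForm g φ x u u v v]
  obtain ⟨u₁, hu₁⟩ : ∃ u₁ : E₁, dπ₁ x u = u₁ := ⟨_, rfl⟩
  rw [hu₁]
  obtain rfl : u = ((u₁, 0) : E₁ × E₂) :=
    Prod.ext ((dπ₁_apply x u).symm.trans hu₁) (mem_distribution₁.1 hu)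
  obtain ⟨v₂, rfl⟩ : ∃ v₂ : E₂, v = ((0, v₂) : E₁ × E₂) :=
    ⟨Prod.snd (α := E₁) (β := E₂) v, Prod.ext (mem_distribution₂.1 hv) rfl⟩
  set f' : E₁ → ℝ := fun y => f ((extChartAt 𝓘(ℝ, E₁) x.1).symm y) with hf'
  set z : E₁ × E₂ := extChartAt (𝓘(ℝ, E₁).prod 𝓘(ℝ, E₂)) x x with hz
  have hz₁ : z.1 = extChartAt 𝓘(ℝ, E₁) x.1 x.1 := by rw [hz, extChartAt_prod]; rfl
  have hz₂ : z.2 = extChartAt 𝓘(ℝ, E₂) x.2 x.2 := by rw [hz, extChartAt_prod]; rfl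
  have hzt₁ : z.1 ∈ (extChartAt 𝓘(ℝ, E₁) x.1).target := hz₁ ▸ mem_extChartAt_target x.1
  have hzt₂ : z.2 ∈ (extChartAt 𝓘(ℝ, E₂) x.2).target := hz₂ ▸ mem_extChartAt_target x.2
  have hf'z : f' z.1 = f x.1 := by rw [hz₁]; exact congrArg f (extChartAt_to_inv x.1)
  have hfs : ContDiffAt ℝ ∞ f' z.1 :=
    contMDiffAt_iff_contDiffAt.1
      ((hf _).comp z.1 (contMDiffAt_extChartAt_symm_of_mem (I := 𝓘(ℝ, E₁)) hzt₁))
  set Φ := writtenInExtChartAt (𝓘(ℝ, E₁).prod 𝓘(ℝ, E₂)) 𝓘(ℝ, F) x φ with hΦdef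
  have hΦ : ContDiffAt ℝ ∞ Φ z := contDiffAt_writtenInExtChartAt hφ.1 x
  have hΦz : Φ z = extChartAt 𝓘(ℝ, F) (φ x) (φ x) := writtenInExtChartAt_self φ x
  have hG : ∀ a b : F, chartMetric g (φ x) (Φ z) a b = (g.inner (φ x) : F →L[ℝ] F →L[ℝ] ℝ) a b :=
    fun a b => by rw [hΦz]; exact chartMetric_self g (φ x) a b
  have hLC : IsLeviCivitaAt (chartMetric g (φ x)) (christoffelCLM (chartMetric g (φ x))) (Φ z) :=
    isLeviCivitaAt_chartMetric g (hΦz ▸ mem_extChartAt_target (φ x))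
  have hLC₁ := isLeviCivitaAt_chartMetric g₁ hzt₁
  have hW := hφ.pullbackMetric_eq x
  have hf'0 : f' z.1 ≠ 0 := hf'z ▸ hf0
  have hd : ∀ w : E₁ × E₂, (mfderiv (𝓘(ℝ, E₁).prod 𝓘(ℝ, E₂)) 𝓘(ℝ, F) φ x w : F) =
      fderiv ℝ Φ z w := fun w =>
    congrArg (fun A : E₁ × E₂ →L[ℝ] F => A w) (fderiv_writtenInExtChartAt hφ.1 x).symm
  have hB : ∀ a b : E₁ × E₂, (ambientDerivative (𝓘(ℝ, E₁).prod 𝓘(ℝ, E₂)) g φ x a b : F) =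
      covHess (christoffelCLM (chartMetric g (φ x))) Φ z a b := fun a b =>
    ambientDerivative_eq_covHess g hφ.1 x a b
  have hG₂ := contDiffAt_chartMetric g₂ hzt₂
  have key := hLC.gauss_warped (u₁ := u₁) (v₂ := v₂) hLC₁ hΦ
    (.of_forall fun y u v => (christoffelCLM_apply _ y u v).symm) hG₂ hfs hf'0 hW
  have huu := fun w => hLC.covHess_leaf (u₁ := u₁) hLC₁ hΦ hG₂ hfs hW w
  have huv := fun w => hLC.covHess_mixed (u₁ := u₁) (v₂ := v₂) hΦ hLC₁.contDiffAt_metric hG₂ hfs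
    hf'0 hW w
  -- The tangential parts of the two Hessians, read on the manifold, turn the brackets of
  -- `gauss_warped` into `h(u,u)` and `h(u,v)`.
  have suu : (secondFundamentalForm (𝓘(ℝ, E₁).prod 𝓘(ℝ, E₂)) g φ x ((u₁, 0) : E₁ × E₂)
      ((u₁, 0) : E₁ × E₂) : F) = covHess (christoffelCLM (chartMetric g (φ x))) Φ z (u₁, 0) (u₁, 0)
        - fderiv ℝ Φ z (christoffelCLM (chartMetric g₁ x.1) z.1 u₁ u₁, 0) := by
    rw [← hB, ← hd]
    refine secondFundamentalForm_eq_sub g φ x _ fun (w : E₁ × E₂) => ?_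
    have h := huu w
    rw [hG, hG, ← hB, ← hd, ← hd] at h
    exact h
  have suv : (secondFundamentalForm (𝓘(ℝ, E₁).prod 𝓘(ℝ, E₂)) g φ x ((u₁, 0) : E₁ × E₂)
      ((0, v₂) : E₁ × E₂) : F) = covHess (christoffelCLM (chartMetric g (φ x))) Φ z (u₁, 0) (0, v₂)
        - (fderiv ℝ f' z.1 u₁ / f' z.1) • fderiv ℝ Φ z (0, v₂) := by
    rw [← hB, ← map_smul, ← hd]
    refine secondFundamentalForm_eq_sub g φ x _ fun (w : E₁ × E₂) => ?_
    have h := huv w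
    rw [hG, hG, ← hB, ← map_smul, ← hd, ← hd] at h
    exact h
  have hvv : warpedMetric g₁ g₂ f x ((0, v₂) : E₁ × E₂) ((0, v₂) : E₁ × E₂) =
      (g.inner (φ x) : F →L[ℝ] F →L[ℝ] ℝ) (fderiv ℝ Φ z (0, v₂)) (fderiv ℝ Φ z (0, v₂)) := by
    rw [← hd]
    exact (hφ.2 x _ _).symm
  have hR : curvatureForm g (φ x)
        (mfderiv (𝓘(ℝ, E₁).prod 𝓘(ℝ, E₂)) 𝓘(ℝ, F) φ x ((0, v₂) : E₁ × E₂))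
        (mfderiv (𝓘(ℝ, E₁).prod 𝓘(ℝ, E₂)) 𝓘(ℝ, F) φ x ((u₁, 0) : E₁ × E₂))
        (mfderiv (𝓘(ℝ, E₁).prod 𝓘(ℝ, E₂)) 𝓘(ℝ, F) φ x ((u₁, 0) : E₁ × E₂)) =
      (g.inner (φ x) : F →L[ℝ] F →L[ℝ] ℝ) (localCurvature (E := F)
        (chartMetric g (φ x)) (Φ z) (fderiv ℝ Φ z (u₁, 0)) (fderiv ℝ Φ z (0, v₂)) (fderiv ℝ Φ z (0, v₂)))
        (fderiv ℝ Φ z (u₁, 0)) := by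
    rw [← hd, ← hd, hΦz]
    rfl
  rw [hG, hG, hG, hG, ← suu, ← suv, ← hvv, ← hR, hf'z, hz₁, ← hB] at key
  exact key

end WarpedGauss

end WarpedChen

end

/-! ### Summation of the mixed Gauss equation over frames. -/

theorem lemma3p1
    {E₁ : Type*} [NormedAddCommGroup E₁] [NormedSpace ℝ E₁] [FiniteDimensional ℝ E₁]
    {E₂ : Type*} [NormedAddCommGroup E₂] [NormedSpace ℝ E₂] [FiniteDimensional ℝ E₂]
    {F : Type*} [NormedAddCommGroup F] [NormedSpace ℝ F] [FiniteDimensional ℝ F]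
    {N₁ : Type*} [TopologicalSpace N₁] [ChartedSpace E₁ N₁] [IsManifold 𝓘(ℝ, E₁) ∞ N₁]
    {N₂ : Type*} [TopologicalSpace N₂] [ChartedSpace E₂ N₂] [IsManifold 𝓘(ℝ, E₂) ∞ N₂]
    {P : Type*} [TopologicalSpace P] [ChartedSpace F P] [IsManifold 𝓘(ℝ, F) ∞ P]
    (g₁ : WarpedChen.Metric E₁ N₁) (g₂ : WarpedChen.Metric E₂ N₂) (g : WarpedChen.Metric F P)
    (f : N₁ → ℝ) (hf : ContMDiff 𝓘(ℝ, E₁) 𝓘(ℝ) ∞ f) (hpos : ∀ y, 0 < f y)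
    (φ : N₁ × N₂ → P)
    (hφ : WarpedChen.IsIsometricImmersion g₁ g₂ f g φ)
    (hmin : WarpedChen.IsDMinimal g₁ g₂ f g φ) (x : N₁ × N₂) :
    WarpedChen.mixedNormSq g₁ g₂ f g φ x =
      WarpedChen.scalarCurvature g (φ x)
          (WarpedChen.tangentImage (𝓘(ℝ, E₁).prod 𝓘(ℝ, E₂)) φ x ⊤)
        - WarpedChen.scalarCurvature g (φ x)
          (WarpedChen.tangentImage (𝓘(ℝ, E₁).prod 𝓘(ℝ, E₂)) φ x
            (WarpedChen.distribution₁ E₁ E₂ x))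
        - WarpedChen.scalarCurvature g (φ x)
          (WarpedChen.tangentImage (𝓘(ℝ, E₁).prod 𝓘(ℝ, E₂)) φ x
            (WarpedChen.distribution₂ E₁ E₂ x))
        - (Module.finrank ℝ E₂ : ℝ) * WarpedChen.laplacian g₁ f x.1 / f x.1 := by
  open WarpedChen in
  have hpx := hpos x.1
  have : FiniteDimensional ℝ (ProdTangent E₁ E₂ x) := inferInstanceAs (FiniteDimensional ℝ (E₁ × E₂))
  let D₁ := distribution₁ (N₁ := N₁) (N₂ := N₂) E₁ E₂ x
  let D₂ := distribution₂ (N₁ := N₁) (N₂ := N₂) E₁ E₂ x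
  let T := mfderiv (𝓘(ℝ, E₁).prod 𝓘(ℝ, E₂)) 𝓘(ℝ, F) φ x
  let e := orthonormalFrame (warpedMetric g₁ g₂ f x) D₁
  let e' := orthonormalFrame (warpedMetric g₁ g₂ f x) D₂
  have he : IsOrthonormalFrame (warpedMetric g₁ g₂ f x) D₁ e :=
    isOrthonormalFrame_orthonormalFrame (warpedForm g₁ g₂ f x) (warpedMetric_symm g₁ g₂ f x)
      (warpedMetric_pos g₁ g₂ hpx) D₁
  have he' : IsOrthonormalFrame (warpedMetric g₁ g₂ f x) D₂ e' :=
    isOrthonormalFrame_orthonormalFrame (warpedForm g₁ g₂ f x) (warpedMetric_symm g₁ g₂ f x)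
      (warpedMetric_pos g₁ g₂ hpx) D₂
  have hE : IsOrthonormalFrame (warpedMetric g₁ g₂ f x) ⊤ (Sum.elim e e') := by
    rw [← distribution₁_sup_distribution₂ x]
    refine he.sumElim he' fun u hu v hv => ?_
    have hu0 : dπ₂ x u = 0 := hu
    have hv0 : dπ₁ x v = 0 := hv
    constructor <;> simp [warpedMetric, hu0, hv0]
  have hT : ∀ u v, g.inner (φ x) (T u) (T v) = warpedMetric g₁ g₂ f x u v := hφ.2 x
  have t₁ := two_mul_scalarCurvature g (φ x) (he.map T.toLinearMap fun u _ v _ => hT u v)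
  have t₂ := two_mul_scalarCurvature g (φ x) (he'.map T.toLinearMap fun u _ v _ => hT u v)
  have t := two_mul_scalarCurvature g (φ x) (hE.map T.toLinearMap fun u _ v _ => hT u v)
  simp only [Fintype.sum_sum_type, Sum.elim_inl, Sum.elim_inr, Finset.sum_add_distrib] at t
  -- The two mixed blocks of the double trace over the whole tangent space agree, so the factor two
  -- of `two_mul_scalarCurvature` cancels.
  have hcross : ∑ b, ∑ a, curvatureForm g (φ x) (T (e a)) (T (e' b)) (T (e' b)) =
      ∑ a, ∑ b, curvatureForm g (φ x) (T (e' b)) (T (e a)) (T (e a)) := by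
    rw [Finset.sum_comm]
    exact Finset.sum_congr rfl fun a _ => Finset.sum_congr rfl fun b _ =>
      curvatureForm_symm g (φ x) _ _
  -- On `𝔇₁` the warped metric is the pull-back of `g₁`, so `dπ₁` carries the leaf frame to an
  -- orthonormal frame of the tangent space of `N₁`.
  have hlap : laplacian g₁ f x.1 = _ := laplacian_eq_sum g₁ x.1 (f := f)
    (e := fun a => dπ₁ x (e a)) (by
      have h := he.map (B' := fun u v => g₁.inner x.1 u v) (dπ₁ x).toLinearMap fun u hu v _ => by
        have hu0 : dπ₂ x u = 0 := hu
        simp [warpedMetric, hu0]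
      have htop : D₁.map (dπ₁ x).toLinearMap = ⊤ := eq_top_iff.2 fun (w : E₁) _ =>
        ⟨((w, 0) : E₁ × E₂), mem_distribution₁.2 rfl, dπ₁_apply x (w, 0)⟩
      rw [htop] at h
      exact h)
  have h1 : ∀ b, warpedMetric g₁ g₂ f x (e' b) (e' b) = 1 := fun b => by simpa using he'.1 b b
  have hmix : mixedNormSq g₁ g₂ f g φ x =
      ∑ a, ∑ b, curvatureForm g (φ x) (T (e' b)) (T (e a)) (T (e a))
        - (Module.finrank ℝ E₂ : ℝ) * laplacian g₁ f x.1 / f x.1 := by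
    -- The zero inserted here is replaced by the product of traces, so that the identity holds
    -- summand by summand.
    rw [hlap, ← finrank_distribution₂ (E₁ := E₁) x, mul_div_assoc, Finset.sum_div, Finset.mul_sum,
      eq_sub_iff_add_eq, ← add_zero (∑ a, ∑ b, curvatureForm g (φ x) _ _ _),
      ← hmin.sum_inner_eq_zero x, ← eq_sub_iff_add_eq', ← Finset.sum_add_distrib, mixedNormSq,
      ← Finset.sum_sub_distrib]
    refine Finset.sum_congr rfl fun a _ => ?_
    -- The right side of the Gauss equation is the same for every unit fiber vector, whence the
    -- factor `n₂`.
    have hc : ∀ c : ℝ, (Module.finrank ℝ D₂ : ℝ) * c = ∑ _b : Fin (Module.finrank ℝ D₂), c :=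
      fun c => by simp
    rw [← Finset.sum_add_distrib, ← Finset.sum_sub_distrib]
    refine (hc _).trans (Finset.sum_congr rfl fun b _ => ?_)
    have h := hφ.gauss_mixed hf x hpx.ne' (he.mem a) (he'.mem b)
    rw [h1, mul_one] at h
    change _ = _ - g.inner (φ x) _ _
    linarith
  simp only [ContinuousLinearMap.coe_coe] at t t₁ t₂
  change 2 * scalarCurvature g (φ x) (tangentImage _ φ x ⊤) = _ at t
  change 2 * scalarCurvature g (φ x) (tangentImage _ φ x (distribution₁ E₁ E₂ x)) = _ at t₁
  change 2 * scalarCurvature g (φ x) (tangentImage _ φ x (distribution₂ E₁ E₂ x)) = _ at t₂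
  linarith
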